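/- An alternating-sign matrix is a square matrix with entries $0$, $1$, $-1$ such that in every row and in every column the nonzero entries alternate in sign and the first and the last nonzero entries are $1$; in particular its first column has exactly one entry $1$, all its other entries being $0$. A $2m\times 2m$ matrix $M$ is half-turn symmetric if $M_{2m+1-i,\,2m+1-j}=M_{i,j}$ for all $1\le i,j\le 2m$; the number of its entries $-1$ is then even. For $n\ge 1$ and $1\le r\le n$ let $A(n,r;x)$ be the total weight of the $n\times n$ alternating-sign matrices whose first column has its entry $1$ in row $r$, where a matrix with $k$ entries equal to $-1$ has weight $x^{k}$. For $m\ge 1$ and $1\le r\le 2m$ let $A_{\mathrm{HT}}(2m,r;x)$ be the total weight of the half-turn symmetric $2m\times 2m$ alternating-sign matrices whose first column has its entry $1$ in row $r$, where a matrix with $k$ entries equal to $-1$ has weight $x^{k/2}$. Put $$\mathcal A(n;t,x)=\sum_{r=1}^{n}A(n,r;x)\,t^{r-1},\qquad \mathcal A_{\mathrm{HT}}(2m;t,x)=\sum_{r=1}^{2m}A_{\mathrm{HT}}(2m,r;x)\,t^{r-1}.$$ Then for every integer $m\ge 1$, and for every element $t$ of an arbitrary commutative ring (equivalently, as an identity of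 polynomials in $t$ with integer coefficients), $$\mathcal A_{\mathrm{HT}}(2m;t,4)=2^{m-1}(1+t)\,\mathcal A(m;t,4)^2.$$ -/

import Mathlib

/-- A finite sequence with entries `0`, `1`, `-1` is *alternating* if it has a nonzero entry, its
first and its last nonzero entries are `1`, and any two consecutive nonzero entries have opposite
signs. -/
structure IsAlternatingLine {n : ℕ} (v : Fin n → SignType) : Prop where
  exists_ne_zero : ∃ i, v i ≠ 0
  first_eq_one : ∀ i, v i ≠ 0 → (∀ j, j < i → v j = 0) → v i = 1
  last_eq_one : ∀ i, v i ≠ 0 → (∀ j, i < j → v j = 0) → v i = 1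
  alternate : ∀ i j, i < j → v i ≠ 0 → v j ≠ 0 → (∀ k, i < k → k < j → v k = 0) → v j = -v i

/-- An `n × n` alternating-sign matrix: every row and every column is an alternating sequence of
the numbers `0`, `1`, `-1`. -/
structure IsASM {n : ℕ} (M : Matrix (Fin n) (Fin n) SignType) : Prop where
  row : ∀ i, IsAlternatingLine (fun j => M i j)
  col : ∀ j, IsAlternatingLine (fun i => M i j)

/-- Half-turn symmetry: the matrix is invariant under rotation by `180` degrees. -/
def IsHalfTurnSymmetric {n : ℕ} (M : Matrix (Fin n) (Fin n) SignType) : Prop :=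
  ∀ i j, M i.rev j.rev = M i j

/-- The number of entries of `M` that are equal to `-1`. -/
def numNegOnes {n : ℕ} (M : Matrix (Fin n) (Fin n) SignType) : ℕ :=
  (Finset.univ.filter (fun p : Fin n × Fin n => M p.1 p.2 = -1)).card

/-- In a half-turn symmetric matrix of even order the number of entries `-1` is even, so that
`numNegOnes M / 2` below is the exact half. -/
theorem even_numNegOnes {m : ℕ} (M : Matrix (Fin (2 * m)) (Fin (2 * m)) SignType)
    (hM : IsHalfTurnSymmetric M) : Even (numNegOnes M) := by
  have hne : ∀ i : Fin (2 * m), i.rev ≠ i := by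
    intro i h
    have h' := congrArg Fin.val h
    rw [Fin.val_rev] at h'
    omega
  have h2 : ((numNegOnes M : ℕ) : ZMod 2) = 0 := by
    unfold numNegOnes
    rw [Finset.card_eq_sum_ones, Nat.cast_sum]
    refine Finset.sum_involution (fun p _ => (p.1.rev, p.2.rev)) ?_ ?_ ?_ ?_
    · intro p _
      decide
    · intro p _ _ h
      exact hne p.1 (congrArg Prod.fst h)
    · intro p hp
      simp only [Finset.mem_filter, Finset.mem_univ, true_and] at hp ⊢
      rw [hM, hp]
    · intro p _
      simp
  exact (ZMod.natCast_eq_zero_iff_even).1 h2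

open Classical in
/-- The total weight `A(n, r; x)` of the `n × n` alternating-sign matrices with the entry `1` of
the first column in row `r`, where a matrix with `k` entries `-1` has weight `x ^ k`.
Rows are numbered from `0`. -/
noncomputable def refinedCount {R : Type*} [CommRing R] (n : ℕ) (r : Fin n) (x : R) : R :=
  ∑ M : Matrix (Fin n) (Fin n) SignType with IsASM M ∧ M r ⟨0, r.pos⟩ = 1, x ^ numNegOnes M

/-- The generating function `𝒜(n; t, x)`, the sum of `A(n, r; x) t ^ (r - 1)` over `r = 1, …, n`;
the index is shifted by one because rows are numbered from `0`. -/
noncomputable def refinedEnum {R : Type*} [CommRing R] (n : ℕ) (t x : R) : R :=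
  ∑ r : Fin n, refinedCount n r x * t ^ (r : ℕ)

open Classical in
/-- The total weight `A_HT(2m, r; x)` of the half-turn symmetric `2m × 2m` alternating-sign
matrices with the entry `1` of the first column in row `r`, where a matrix with `k` entries `-1`
has weight `x ^ (k / 2)`. Rows are numbered from `0`. -/
noncomputable def refinedCountHT {R : Type*} [CommRing R] (m : ℕ) (r : Fin (2 * m)) (x : R) : R :=
  ∑ M : Matrix (Fin (2 * m)) (Fin (2 * m)) SignType with
    IsASM M ∧ IsHalfTurnSymmetric M ∧ M r ⟨0, r.pos⟩ = 1, x ^ (numNegOnes M / 2)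

/-- The generating function `𝒜_HT(2m; t, x)`, the sum of `A_HT(2m, r; x) t ^ (r - 1)` over
`r = 1, …, 2m`. -/
noncomputable def refinedEnumHT {R : Type*} [CommRing R] (m : ℕ) (t x : R) : R :=
  ∑ r : Fin (2 * m), refinedCountHT m r x * t ^ (r : ℕ)

/-!
# Half-turn symmetric alternating-sign matrices at weight 4

Alternating-sign matrices are the states of the six-vertex model with domain wall boundary. Give
the vertex on row line `x` and column line `y` the weight `w = x - y`, `1 - w` or `1` according to
its type: `w` at a zero entry whose partial row sum (to the left) and partial column sum (above)
agree, `1 - w` at a zero entry where they differ, and `1` at a nonzero entry. At `w = 1 / 2` a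
matrix with `k` entries `-1` gets weight proportional to `4 ^ k`. Half-turn symmetric matrices of
order `2n` correspond to states of their upper half, with `2n` columns carrying the parameters
`y₀, …, yₙ₋₁, yₙ₋₁, …, y₀` and with column sums `t j + t (rev j) = 1`.

For these weights the two partition functions satisfy `Z_HT(2n; x, y) = Z(n; x, y) ^ 2` for all
parameters (`foldedPartition_eq_sq_of_separated`, and `foldedPartition_eq_sq` for equal `x`).
The proof is by induction on `n`, following Izergin and Korepin:

* the row-to-row transfer matrices commute by the Yang–Baxter equation (`stack_vertexMatrix`,
  `commute_transfer`), so both sides are symmetric in the `x`'s;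
* as functions of `y₀` both sides are polynomials of degree less than `2n`
  (`isPolyLT_partitionMatrix`, `isPolyLT_foldedPartition`);
* at `y₀ = x` and at `y₀ = x - 1`, for each of the `n` row parameters `x`, a corner vertex is
  forced to be an entry `1`; this freezes the lines through it and reduces both sides to size
  `n - 1` with equal factors (the lemmas `partitionMatrix_freeze_left` and so on).

For generic `x`'s these are `2n` distinct points, which suffices; equal `x`'s follow by continuity.

Finally let all `x` be `1 / 2`, let `y₀ = 1 / 2 - w`, and let the other `y`'s vanish. The entry `1`
of the first column in row `r` (counted from `0`) then contributes `w ^ r * (1 - w) ^ (n - 1 - r)`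
up to constants, so that `t = w / (1 - w)` turns the identity into the theorem for positive real
`t` (`refinedEnumHT_four_of_pos`). As both sides are polynomials in `t` with integer coefficients,
this gives the identity over `ℤ[X]` and hence in every commutative ring.
-/

open Matrix Kronecker

/-! ### The six-vertex weights and commuting transfer matrices -/

/-- The weight of a vertex with left, top, right and bottom edge `h`, `s`, `h'`, `s'`. The edge
values are the partial row and column sums before and after the vertex, with `true` for `1`, so the
weight vanishes unless `h' - h = s' - s`, the common difference being the matrix entry. -/
def vertexWeight (w : ℝ) : Bool → Bool → Bool → Bool → ℝ
  | false, false, false, false => w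
  | true, true, true, true => w
  | false, true, false, true => 1 - w
  | true, false, true, false => 1 - w
  | false, false, true, true => 1
  | true, true, false, false => 1
  | _, _, _, _ => 0

/-- The `L`-operator: the vertex weights with top edge `s` and bottom edge `s'` as a matrix from the
left edge to the right edge. -/
def vertexMatrix (w : ℝ) (s s' : Bool) : Matrix Bool Bool ℝ :=
  Matrix.of fun h h' => vertexWeight w h s h' s'

theorem sum_fin_succ_fun {α M : Type*} [Fintype α] [AddCommMonoid M] {n : ℕ}
    (F : (Fin (n + 1) → α) → M) :
    ∑ s, F s = ∑ a, ∑ t : Fin n → α, F (Fin.cons a t) := by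
  rw [← (Fin.consEquiv (fun _ : Fin (n + 1) => α)).sum_comp F, Fintype.sum_prod_type]
  rfl

/-- The monodromy matrix of a row line `x` crossing the column lines `y`, with the column edges `s`
above and `s'` below the row. -/
def rowMatrix (x : ℝ) : {N : ℕ} → (Fin N → ℝ) → (Fin N → Bool) → (Fin N → Bool) →
    Matrix Bool Bool ℝ
  | 0, _, _, _ => 1
  | _ + 1, y, s, s' => vertexMatrix (x - y 0) (s 0) (s' 0) *
      rowMatrix x (Fin.tail y) (Fin.tail s) (Fin.tail s')

/-- The monodromy matrix of a row line `x` crossing `2N` column lines with parameters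
`y₀, …, y_{N-1}, y_{N-1}, …, y₀`. The edges on the two columns with parameter `y j` form the pair
`s j`, so that the outermost pair can be split off in a recursion. -/
def foldedRowMatrix (x : ℝ) : {N : ℕ} → (Fin N → ℝ) → (Fin N → Bool × Bool) →
    (Fin N → Bool × Bool) → Matrix Bool Bool ℝ
  | 0, _, _, _ => 1
  | _ + 1, y, s, s' => vertexMatrix (x - y 0) (s 0).1 (s' 0).1 *
      foldedRowMatrix x (Fin.tail y) (Fin.tail s) (Fin.tail s') *
      vertexMatrix (x - y 0) (s 0).2 (s' 0).2

/-- The `R`-matrix intertwining two row lines whose parameters differ by `d`. -/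
def rMatrix (d : ℝ) : Matrix (Bool × Bool) (Bool × Bool) ℝ :=
  Matrix.of fun p q =>
    match p, q with
    | (false, false), (false, false) => 1 - d
    | (true, true), (true, true) => 1 - d
    | (false, true), (false, true) => 1
    | (true, false), (true, false) => 1
    | (false, true), (true, false) => d
    | (true, false), (false, true) => d
    | _, _ => 0

/-- The monodromy matrix of two rows `A` above `B`, summed over the edges between them. -/
def stack {α : Type*} [Fintype α] (A B : α → α → Matrix Bool Bool ℝ) (s s' : α) :
    Matrix (Bool × Bool) (Bool × Bool) ℝ :=
  ∑ m, A s m ⊗ₖ B m s'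

set_option maxHeartbeats 1000000 in
/-- The Yang–Baxter (RLL) equation. -/
theorem stack_vertexMatrix (x x' y : ℝ) (s s' : Bool) :
    rMatrix (x - x') * stack (vertexMatrix (x - y)) (vertexMatrix (x' - y)) s s' =
      stack (vertexMatrix (x' - y)) (vertexMatrix (x - y)) s s' * rMatrix (x - x') := by
  ext ⟨a, b⟩ ⟨c, e⟩
  simp only [Matrix.mul_apply, Fintype.sum_prod_type, stack, Fintype.sum_bool, Matrix.add_apply,
    Matrix.kroneckerMap_apply, rMatrix, vertexMatrix, Matrix.of_apply]
  cases s <;> cases s' <;> cases a <;> cases b <;> cases c <;> cases e <;>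
    (simp only [vertexWeight]; ring)

theorem stack_rowMatrix (x x' : ℝ) {N : ℕ} (y : Fin N → ℝ) (s s' : Fin N → Bool) :
    rMatrix (x - x') * stack (rowMatrix x y) (rowMatrix x' y) s s' =
      stack (rowMatrix x' y) (rowMatrix x y) s s' * rMatrix (x - x') := by
  induction N with
  | zero => simp [stack, rowMatrix]
  | succ N ih =>
    have key : ∀ u v : ℝ, stack (rowMatrix u y) (rowMatrix v y) s s' =
        stack (vertexMatrix (u - y 0)) (vertexMatrix (v - y 0)) (s 0) (s' 0) *
          stack (rowMatrix u (Fin.tail y)) (rowMatrix v (Fin.tail y)) (Fin.tail s)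
            (Fin.tail s') := by
      intro u v
      simp only [stack, sum_fin_succ_fun, rowMatrix, Fin.cons_zero, Fin.tail_cons,
        Matrix.mul_kronecker_mul, Finset.sum_mul_sum]
    rw [key, key, ← mul_assoc, stack_vertexMatrix, mul_assoc, ih, mul_assoc]

theorem stack_foldedRowMatrix (x x' : ℝ) {N : ℕ} (y : Fin N → ℝ) (s s' : Fin N → Bool × Bool) :
    rMatrix (x - x') * stack (foldedRowMatrix x y) (foldedRowMatrix x' y) s s' =
      stack (foldedRowMatrix x' y) (foldedRowMatrix x y) s s' * rMatrix (x - x') := by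
  induction N with
  | zero => simp [stack, foldedRowMatrix]
  | succ N ih =>
    have key : ∀ u v : ℝ, stack (foldedRowMatrix u y) (foldedRowMatrix v y) s s' =
        stack (vertexMatrix (u - y 0)) (vertexMatrix (v - y 0)) (s 0).1 (s' 0).1 *
          stack (foldedRowMatrix u (Fin.tail y)) (foldedRowMatrix v (Fin.tail y)) (Fin.tail s)
            (Fin.tail s') *
          stack (vertexMatrix (u - y 0)) (vertexMatrix (v - y 0)) (s 0).2 (s' 0).2 := by
      intro u v
      simp only [stack, sum_fin_succ_fun, foldedRowMatrix, Fin.cons_zero, Fin.tail_cons,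
        Matrix.mul_kronecker_mul, Finset.sum_mul, Finset.mul_sum, Fintype.sum_prod_type]
      rw [Finset.sum_comm]
      refine Finset.sum_congr rfl fun a _ => ?_
      rw [Finset.sum_comm]
    rw [key, key]
    calc _ = (rMatrix (x - x') * stack (vertexMatrix (x - y 0)) (vertexMatrix (x' - y 0))
              (s 0).1 (s' 0).1) *
          stack (foldedRowMatrix x (Fin.tail y)) (foldedRowMatrix x' (Fin.tail y)) (Fin.tail s)
            (Fin.tail s') *
          stack (vertexMatrix (x - y 0)) (vertexMatrix (x' - y 0)) (s 0).2 (s' 0).2 := by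
            simp only [mul_assoc]
      _ = stack (vertexMatrix (x' - y 0)) (vertexMatrix (x - y 0)) (s 0).1 (s' 0).1 *
          (rMatrix (x - x') *
          stack (foldedRowMatrix x (Fin.tail y)) (foldedRowMatrix x' (Fin.tail y)) (Fin.tail s)
            (Fin.tail s')) *
          stack (vertexMatrix (x - y 0)) (vertexMatrix (x' - y 0)) (s 0).2 (s' 0).2 := by
            rw [stack_vertexMatrix]; simp only [mul_assoc]
      _ = stack (vertexMatrix (x' - y 0)) (vertexMatrix (x - y 0)) (s 0).1 (s' 0).1 *
          stack (foldedRowMatrix x' (Fin.tail y)) (foldedRowMatrix x (Fin.tail y)) (Fin.tail s)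
            (Fin.tail s') *
          (rMatrix (x - x') *
          stack (vertexMatrix (x - y 0)) (vertexMatrix (x' - y 0)) (s 0).2 (s' 0).2) := by
            rw [ih]; simp only [mul_assoc]
      _ = _ := by rw [stack_vertexMatrix]; simp only [mul_assoc]

/-- The row-to-row transfer matrix: the partial row sum is `0` at the left end of the row and `1` at
its right end. -/
def transfer {α : Type*} (A : α → α → Matrix Bool Bool ℝ) : Matrix α α ℝ :=
  Matrix.of fun s s' => A s s' false true

theorem transfer_mul_apply {α : Type*} [Fintype α] (A B : α → α → Matrix Bool Bool ℝ) (s s' : α) :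
    (transfer A * transfer B) s s' = stack A B s s' (false, false) (true, true) := by
  simp [transfer, Matrix.mul_apply, stack, Matrix.sum_apply]

/-- The entry of the intertwining relation from `(0, 0)` to `(1, 1)` is `1 - d` times the
commutation relation, where `d = x - x'`. -/
theorem commute_transfer {α : Type*} [Fintype α] (A : ℝ → α → α → Matrix Bool Bool ℝ)
    (hA : ∀ x x' s s', rMatrix (x - x') * stack (A x) (A x') s s' =
      stack (A x') (A x) s s' * rMatrix (x - x')) (x x' : ℝ) :
    Commute (transfer (A x)) (transfer (A x')) := by
  have key : ∀ x x' : ℝ, x - x' ≠ 1 → Commute (transfer (A x)) (transfer (A x')) := by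
    intro x x' h
    ext s s'
    have h0 : (1 : ℝ) - (x - x') ≠ 0 := fun h' => h (by linarith)
    have := congrFun (congrFun (hA x x' s s') (false, false)) (true, true)
    simp only [Matrix.mul_apply, Fintype.sum_prod_type, Fintype.sum_bool, rMatrix,
      Matrix.of_apply, zero_mul, mul_zero, zero_add, add_zero] at this
    rw [transfer_mul_apply, transfer_mul_apply]
    exact mul_left_cancel₀ h0 (by rw [this, mul_comm])
  -- if `1 - d` vanishes, exchange the two rows
  by_cases h : x - x' = 1
  · exact (key x' x (by intro h'; linarith)).symm
  · exact key x x' h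

theorem commute_rowMatrix {N : ℕ} (y : Fin N → ℝ) (x x' : ℝ) :
    Commute (transfer (rowMatrix x y)) (transfer (rowMatrix x' y)) :=
  commute_transfer (fun x => rowMatrix x y) (fun x x' => stack_rowMatrix x x' y) x x'

theorem commute_foldedRowMatrix {N : ℕ} (y : Fin N → ℝ) (x x' : ℝ) :
    Commute (transfer (foldedRowMatrix x y)) (transfer (foldedRowMatrix x' y)) :=
  commute_transfer (fun x => foldedRowMatrix x y) (fun x x' => stack_foldedRowMatrix x x' y) x x'

/-! ### Partition functions and removal of the first column line -/

theorem rowMatrix_cons (x y₀ : ℝ) {N : ℕ} (y : Fin N → ℝ) (a b : Bool) (s t : Fin N → Bool) :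
    rowMatrix x (Fin.cons y₀ y : Fin (N + 1) → ℝ) (Fin.cons a s) (Fin.cons b t) =
      vertexMatrix (x - y₀) a b * rowMatrix x y s t := by
  simp [rowMatrix]

theorem foldedRowMatrix_cons (x y₀ : ℝ) {N : ℕ} (y : Fin N → ℝ) (a b : Bool × Bool)
    (s t : Fin N → Bool × Bool) :
    foldedRowMatrix x (Fin.cons y₀ y : Fin (N + 1) → ℝ) (Fin.cons a s) (Fin.cons b t) =
      vertexMatrix (x - y₀) a.1 b.1 * foldedRowMatrix x y s t * vertexMatrix (x - y₀) a.2 b.2 := by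
  simp [foldedRowMatrix]

/-- The partition function of rows with parameters `l`, from top to bottom, crossing the column
lines `y`, as a matrix in the column edges at the top and at the bottom. Its entry from all `false`
to all `true` is the domain wall partition function. -/
def partitionMatrix {N : ℕ} (y : Fin N → ℝ) (l : List ℝ) :
    Matrix (Fin N → Bool) (Fin N → Bool) ℝ :=
  (l.map fun x => transfer (rowMatrix x y)).prod

/-- The partition function of the upper half of a half-turn symmetric lattice, with column edges `s`
at the top. At the bottom, exactly one of the two edges of each pair carries `true`. -/
def foldedPartition {N : ℕ} (y : Fin N → ℝ) (l : List ℝ) (s : Fin N → Bool × Bool) : ℝ :=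
  ∑ t, (l.map fun x => transfer (foldedRowMatrix x y)).prod s t *
    if ∀ j, (t j).1 ≠ (t j).2 then 1 else 0

theorem partitionMatrix_perm {N : ℕ} (y : Fin N → ℝ) {l l' : List ℝ} (h : l.Perm l') :
    partitionMatrix y l = partitionMatrix y l' := by
  refine (h.map _).prod_eq' ?_
  rw [List.pairwise_map]
  exact List.pairwise_of_forall fun x x' => commute_rowMatrix y x x'

theorem foldedPartition_perm {N : ℕ} (y : Fin N → ℝ) {l l' : List ℝ} (h : l.Perm l') :
    foldedPartition y l = foldedPartition y l' := by
  have : (l.map fun x => transfer (foldedRowMatrix x y)).prod =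
      (l'.map fun x => transfer (foldedRowMatrix x y)).prod := by
    refine (h.map _).prod_eq' ?_
    rw [List.pairwise_map]
    exact List.pairwise_of_forall fun x x' => commute_foldedRowMatrix y x x'
  funext s
  simp only [foldedPartition, this]

theorem partitionMatrix_cons {N : ℕ} (y : Fin N → ℝ) (x : ℝ) (l : List ℝ) (s t : Fin N → Bool) :
    partitionMatrix y (x :: l) s t =
      ∑ u, rowMatrix x y s u false true * partitionMatrix y l u t := by
  simp [partitionMatrix, Matrix.mul_apply, transfer]

theorem foldedPartition_cons {N : ℕ} (y : Fin N → ℝ) (x : ℝ) (l : List ℝ)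
    (s : Fin N → Bool × Bool) :
    foldedPartition y (x :: l) s =
      ∑ u, foldedRowMatrix x y s u false true * foldedPartition y l u := by
  simp only [foldedPartition, List.map_cons, List.prod_cons, Matrix.mul_apply, transfer,
    Matrix.of_apply, Finset.sum_mul, Finset.mul_sum]
  rw [Finset.sum_comm]
  simp only [mul_assoc]

/-- Once the first column carries `true`, all its further vertices have an entry `0` and weight
`1 - w`. -/
theorem partitionMatrix_cons_true {N : ℕ} (y₀ : ℝ) (y : Fin N → ℝ) (l : List ℝ)
    (s t : Fin N → Bool) :
    partitionMatrix (Fin.cons y₀ y : Fin (N + 1) → ℝ) l (Fin.cons true s) (Fin.cons true t) =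
      (l.map fun x => 1 - (x - y₀)).prod * partitionMatrix y l s t := by
  induction l generalizing s with
  | nil => simp [partitionMatrix, Matrix.one_apply, Fin.cons_inj]
  | cons x l ih =>
    rw [partitionMatrix_cons, partitionMatrix_cons, sum_fin_succ_fun]
    simp only [rowMatrix_cons, Fintype.sum_bool, ih, Matrix.mul_apply, vertexMatrix,
      Matrix.of_apply, vertexWeight, List.map_cons, List.prod_cons, Finset.mul_sum, zero_mul,
      zero_add, add_zero, Finset.sum_const_zero]
    exact Finset.sum_congr rfl fun u _ => by ring

/-- If the first column is to change from `false` to `true`, it does so either below the top row or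
in it; in the latter case the rest of the top row starts from `true`. -/
theorem partitionMatrix_cons_false {N : ℕ} (y₀ : ℝ) (y : Fin N → ℝ) (x : ℝ) (l : List ℝ)
    (s t : Fin N → Bool) :
    partitionMatrix (Fin.cons y₀ y : Fin (N + 1) → ℝ) (x :: l) (Fin.cons false s)
        (Fin.cons true t) =
      (x - y₀) * ∑ u, rowMatrix x y s u false true *
        partitionMatrix (Fin.cons y₀ y : Fin (N + 1) → ℝ) l (Fin.cons false u) (Fin.cons true t) +
      (l.map fun x => 1 - (x - y₀)).prod *
        ∑ u, rowMatrix x y s u true true * partitionMatrix y l u t := by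
  rw [partitionMatrix_cons, sum_fin_succ_fun]
  simp only [rowMatrix_cons, Fintype.sum_bool, partitionMatrix_cons_true, Matrix.mul_apply,
    vertexMatrix, Matrix.of_apply, vertexWeight, Finset.mul_sum, zero_mul,
    zero_add, add_zero]
  rw [add_comm]
  exact congrArg₂ _ (Finset.sum_congr rfl fun u _ => by ring)
    (Finset.sum_congr rfl fun u _ => by ring)

theorem partitionMatrix_nil_false {N : ℕ} (y₀ : ℝ) (y : Fin N → ℝ) (s t : Fin N → Bool) :
    partitionMatrix (Fin.cons y₀ y : Fin (N + 1) → ℝ) [] (Fin.cons false s)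
        (Fin.cons true t) = 0 := by
  simp [partitionMatrix, Fin.cons_inj]

theorem foldedPartition_nil_cons {N : ℕ} (y₀ : ℝ) (y : Fin N → ℝ) (p : Bool × Bool)
    (s : Fin N → Bool × Bool) :
    foldedPartition (Fin.cons y₀ y : Fin (N + 1) → ℝ) [] (Fin.cons p s) =
      if p.1 ≠ p.2 then foldedPartition y [] s else 0 := by
  simp only [foldedPartition, List.map_nil, List.prod_nil, Matrix.one_apply, ite_mul, one_mul,
    zero_mul, Finset.sum_ite_eq, Finset.mem_univ, if_true, Fin.forall_fin_succ, Fin.cons_zero,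
    Fin.cons_succ]
  split_ifs <;> simp_all

/-- The partial sums of the two outer columns cannot decrease, so these columns cannot end with the
sums `0` and `1` in some order. -/
theorem foldedPartition_cons_true_true {N : ℕ} (y₀ : ℝ) (y : Fin N → ℝ) (l : List ℝ)
    (s : Fin N → Bool × Bool) :
    foldedPartition (Fin.cons y₀ y : Fin (N + 1) → ℝ) l (Fin.cons (true, true) s) = 0 := by
  induction l generalizing s with
  | nil => simp [foldedPartition_nil_cons]
  | cons x l ih =>
    rw [foldedPartition_cons, sum_fin_succ_fun]
    simp only [Fintype.sum_prod_type, Fintype.sum_bool, foldedRowMatrix_cons, ih, Matrix.mul_apply,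
      vertexMatrix, Matrix.of_apply, vertexWeight, zero_mul, mul_zero, zero_add, add_zero,
      Finset.sum_const_zero]

theorem foldedPartition_cons_true_false {N : ℕ} (y₀ : ℝ) (y : Fin N → ℝ) (l : List ℝ)
    (s : Fin N → Bool × Bool) :
    foldedPartition (Fin.cons y₀ y : Fin (N + 1) → ℝ) l (Fin.cons (true, false) s) =
      (l.map fun x => (1 - (x - y₀)) ^ 2).prod * foldedPartition y l s := by
  induction l generalizing s with
  | nil => simp [foldedPartition_nil_cons]
  | cons x l ih =>
    rw [foldedPartition_cons, foldedPartition_cons, sum_fin_succ_fun]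
    simp only [Fintype.sum_prod_type, Fintype.sum_bool, foldedRowMatrix_cons, ih, Matrix.mul_apply,
      vertexMatrix, Matrix.of_apply, vertexWeight, zero_mul, mul_zero, zero_add, add_zero,
      Finset.sum_const_zero, foldedPartition_cons_true_true, List.map_cons, List.prod_cons,
      Finset.mul_sum]
    exact Finset.sum_congr rfl fun u _ => by ring

theorem foldedPartition_cons_false_true {N : ℕ} (y₀ : ℝ) (y : Fin N → ℝ) (l : List ℝ)
    (s : Fin N → Bool × Bool) :
    foldedPartition (Fin.cons y₀ y : Fin (N + 1) → ℝ) l (Fin.cons (false, true) s) =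
      (l.map fun x => (x - y₀) ^ 2).prod * foldedPartition y l s := by
  induction l generalizing s with
  | nil => simp [foldedPartition_nil_cons]
  | cons x l ih =>
    rw [foldedPartition_cons, foldedPartition_cons, sum_fin_succ_fun]
    simp only [Fintype.sum_prod_type, Fintype.sum_bool, foldedRowMatrix_cons, ih, Matrix.mul_apply,
      vertexMatrix, Matrix.of_apply, vertexWeight, zero_mul, mul_zero, zero_add, add_zero,
      Finset.sum_const_zero, foldedPartition_cons_true_true, List.map_cons, List.prod_cons,
      Finset.mul_sum]
    exact Finset.sum_congr rfl fun u _ => by ring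

/-- The first summand has the entry `0` in both outer columns of the top row; in the other two
exactly one of the outer columns has its entry `1` there. -/
theorem foldedPartition_cons_false_false {N : ℕ} (y₀ : ℝ) (y : Fin N → ℝ) (x : ℝ) (l : List ℝ)
    (s : Fin N → Bool × Bool) :
    foldedPartition (Fin.cons y₀ y : Fin (N + 1) → ℝ) (x :: l) (Fin.cons (false, false) s) =
      (x - y₀) * (1 - (x - y₀)) * ∑ u, foldedRowMatrix x y s u false true *
        foldedPartition (Fin.cons y₀ y : Fin (N + 1) → ℝ) l (Fin.cons (false, false) u) +
      (1 - (x - y₀)) * (l.map fun x => (1 - (x - y₀)) ^ 2).prod *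
        ∑ u, foldedRowMatrix x y s u true true * foldedPartition y l u +
      (x - y₀) * (l.map fun x => (x - y₀) ^ 2).prod *
        ∑ u, foldedRowMatrix x y s u false false * foldedPartition y l u := by
  rw [foldedPartition_cons, sum_fin_succ_fun]
  simp only [Fintype.sum_prod_type, Fintype.sum_bool, foldedRowMatrix_cons, Matrix.mul_apply,
    vertexMatrix, Matrix.of_apply, vertexWeight, zero_mul, mul_zero, zero_add, add_zero,
    foldedPartition_cons_true_true, foldedPartition_cons_true_false,
    foldedPartition_cons_false_true, Finset.mul_sum, ← Finset.sum_add_distrib]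
  exact Finset.sum_congr rfl fun u _ => by ring

theorem foldedPartition_nil_false_false {N : ℕ} (y₀ : ℝ) (y : Fin N → ℝ)
    (s : Fin N → Bool × Bool) :
    foldedPartition (Fin.cons y₀ y : Fin (N + 1) → ℝ) [] (Fin.cons (false, false) s) = 0 := by
  simp [foldedPartition_nil_cons]

theorem rowMatrix_false_true_true (x : ℝ) {N : ℕ} (y : Fin N → ℝ) (t : Fin N → Bool) :
    rowMatrix x y (fun _ => false) t true true =
      if t = fun _ => false then ∏ j, (1 - (x - y j)) else 0 := by
  induction N with
  | zero => simp [rowMatrix, Subsingleton.elim t fun _ => false]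
  | succ N ih =>
    have : (t = fun _ => false) ↔ t 0 = false ∧ Fin.tail t = fun _ => false := by
      simp [funext_iff, Fin.forall_fin_succ, Fin.tail]
    have ht : Fin.tail (fun _ : Fin (N + 1) => false) = fun _ => false := rfl
    rw [rowMatrix, Matrix.mul_apply, Fintype.sum_bool, ht, ih, if_congr this rfl rfl,
      Fin.prod_univ_succ]
    cases t 0 <;> simp [vertexMatrix, vertexWeight, Fin.tail]

theorem rowMatrix_true_true_true (x : ℝ) {N : ℕ} (y : Fin N → ℝ) (s : Fin N → Bool) :
    rowMatrix x y s (fun _ => true) true true =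
      if s = fun _ => true then ∏ j, (x - y j) else 0 := by
  induction N with
  | zero => simp [rowMatrix, Subsingleton.elim s fun _ => true]
  | succ N ih =>
    have : (s = fun _ => true) ↔ s 0 = true ∧ Fin.tail s = fun _ => true := by
      simp [funext_iff, Fin.forall_fin_succ, Fin.tail]
    have ht : Fin.tail (fun _ : Fin (N + 1) => true) = fun _ => true := rfl
    rw [rowMatrix, Matrix.mul_apply, Fintype.sum_bool, ht, ih, if_congr this rfl rfl,
      Fin.prod_univ_succ]
    cases s 0 <;> simp [vertexMatrix, vertexWeight, Fin.tail]

theorem foldedRowMatrix_false_true_false (x : ℝ) {N : ℕ} (y : Fin N → ℝ)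
    (t : Fin N → Bool × Bool) :
    foldedRowMatrix x y (fun _ => (false, false)) t true false = 0 := by
  induction N with
  | zero => simp [foldedRowMatrix]
  | succ N ih =>
    have ht : Fin.tail (fun _ : Fin (N + 1) => (false, false)) = fun _ => (false, false) := rfl
    simp only [foldedRowMatrix, Matrix.mul_apply, Fintype.sum_bool, ht, ih]
    cases (t 0).1 <;> cases (t 0).2 <;> simp [vertexMatrix, vertexWeight]

theorem foldedRowMatrix_false_true_true (x : ℝ) {N : ℕ} (y : Fin N → ℝ)
    (t : Fin N → Bool × Bool) :
    foldedRowMatrix x y (fun _ => (false, false)) t true true =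
      if t = fun _ => (false, false) then ∏ j, (1 - (x - y j)) ^ 2 else 0 := by
  induction N with
  | zero => simp [foldedRowMatrix, Subsingleton.elim t fun _ => (false, false)]
  | succ N ih =>
    have : (t = fun _ => (false, false)) ↔
        ((t 0).1 = false ∧ (t 0).2 = false) ∧ Fin.tail t = fun _ => (false, false) := by
      simp [funext_iff, Fin.forall_fin_succ, Fin.tail, Prod.ext_iff]
    have ht : Fin.tail (fun _ : Fin (N + 1) => (false, false)) = fun _ => (false, false) := rfl
    simp only [foldedRowMatrix, Matrix.mul_apply, Fintype.sum_bool, ht, ih,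
      foldedRowMatrix_false_true_false]
    rw [if_congr this rfl rfl, Fin.prod_univ_succ]
    cases (t 0).1 <;> cases (t 0).2 <;> simp [vertexMatrix, vertexWeight, Fin.tail]
    split_ifs <;> ring

theorem foldedRowMatrix_false_false_false (x : ℝ) {N : ℕ} (y : Fin N → ℝ)
    (t : Fin N → Bool × Bool) :
    foldedRowMatrix x y (fun _ => (false, false)) t false false =
      if t = fun _ => (false, false) then ∏ j, (x - y j) ^ 2 else 0 := by
  induction N with
  | zero => simp [foldedRowMatrix, Subsingleton.elim t fun _ => (false, false)]
  | succ N ih =>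
    have : (t = fun _ => (false, false)) ↔
        ((t 0).1 = false ∧ (t 0).2 = false) ∧ Fin.tail t = fun _ => (false, false) := by
      simp [funext_iff, Fin.forall_fin_succ, Fin.tail, Prod.ext_iff]
    have ht : Fin.tail (fun _ : Fin (N + 1) => (false, false)) = fun _ => (false, false) := rfl
    simp only [foldedRowMatrix, Matrix.mul_apply, Fintype.sum_bool, ht, ih,
      foldedRowMatrix_false_true_false]
    rw [if_congr this rfl rfl, Fin.prod_univ_succ]
    cases (t 0).1 <;> cases (t 0).2 <;> simp [vertexMatrix, vertexWeight, Fin.tail]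
    split_ifs <;> ring

/-! ### Frozen corners -/

/-- At `y₀ = x` the upper left corner has `w = 0` and must be an entry `1`, which freezes the first
row and the first column. -/
theorem partitionMatrix_freeze_left {N : ℕ} (x : ℝ) (y : Fin N → ℝ) (l : List ℝ)
    (t : Fin N → Bool) :
    partitionMatrix (Fin.cons x y : Fin (N + 1) → ℝ) (x :: l) (Fin.cons false fun _ => false)
        (Fin.cons true t) =
      (l.map fun z => 1 - (z - x)).prod * (∏ j, (1 - (x - y j))) *
        partitionMatrix y l (fun _ => false) t := by
  rw [partitionMatrix_cons_false]
  simp [rowMatrix_false_true_true, mul_assoc]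

/-- At `y₀ = x - 1` the lower left corner has `1 - w = 0` and must be an entry `1`, which freezes
the last row and the first column. -/
theorem partitionMatrix_freeze_right {N : ℕ} (x y₀ : ℝ) (hx : 1 - (x - y₀) = 0) (y : Fin N → ℝ)
    (l : List ℝ) (s : Fin N → Bool) :
    partitionMatrix (Fin.cons y₀ y : Fin (N + 1) → ℝ) (l ++ [x]) (Fin.cons false s)
        (Fin.cons true fun _ => true) =
      (l.map fun z => z - y₀).prod * (∏ j, (x - y j)) *
        partitionMatrix y l s (fun _ => true) := by
  induction l generalizing s with
  | nil =>
    simp only [List.nil_append, partitionMatrix_cons_false, partitionMatrix_nil_false, mul_zero,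
      Finset.sum_const_zero, List.map_nil, List.prod_nil, zero_add, one_mul]
    simp only [partitionMatrix, List.map_nil, List.prod_nil, Matrix.one_apply, mul_ite, mul_one,
      mul_zero, Finset.sum_ite_eq', Finset.mem_univ, if_true, rowMatrix_true_true_true]
  | cons z l ih =>
    rw [List.cons_append, partitionMatrix_cons_false]
    simp only [ih, List.map_append, List.map_cons, List.map_nil, List.prod_append, hx,
      List.prod_cons, List.prod_nil, mul_one, mul_zero, zero_mul, Finset.sum_const_zero, add_zero,
      partitionMatrix_cons, Finset.mul_sum]
    exact Finset.sum_congr rfl fun u _ => by ring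

/-- At `y₀ = x` the upper left corner is frozen to be an entry `1`. -/
theorem foldedPartition_freeze_left {N : ℕ} (x : ℝ) (y : Fin N → ℝ) (l : List ℝ) :
    foldedPartition (Fin.cons x y : Fin (N + 1) → ℝ) (x :: l)
        (Fin.cons (false, false) fun _ => (false, false)) =
      (l.map fun z => (1 - (z - x)) ^ 2).prod * (∏ j, (1 - (x - y j)) ^ 2) *
        foldedPartition y l (fun _ => (false, false)) := by
  rw [foldedPartition_cons_false_false]
  simp [foldedRowMatrix_false_true_true, mul_assoc]

/-- At `y₀ = x - 1` the upper right corner is frozen to be an entry `1`. -/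
theorem foldedPartition_freeze_right {N : ℕ} (x y₀ : ℝ) (hx : 1 - (x - y₀) = 0) (y : Fin N → ℝ)
    (l : List ℝ) :
    foldedPartition (Fin.cons y₀ y : Fin (N + 1) → ℝ) (x :: l)
        (Fin.cons (false, false) fun _ => (false, false)) =
      (l.map fun z => (z - y₀) ^ 2).prod * (∏ j, (x - y j) ^ 2) *
        foldedPartition y l (fun _ => (false, false)) := by
  have hx' : x - y₀ = 1 := by linarith
  rw [foldedPartition_cons_false_false]
  simp [foldedRowMatrix_false_false_false, mul_assoc, hx']

/-! ### Interpolation in the first column parameter -/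

open Polynomial in
/-- `f` is a polynomial function of degree less than `d`. -/
def IsPolyLT (d : ℕ) (f : ℝ → ℝ) : Prop :=
  ∃ p : ℝ[X], p.degree < d ∧ ∀ y, f y = p.eval y

namespace IsPolyLT

open Polynomial

theorem zero (d : ℕ) : IsPolyLT d fun _ => 0 :=
  ⟨0, by simp, by simp⟩

theorem const (c : ℝ) : IsPolyLT 1 fun _ => c :=
  ⟨C c, lt_of_le_of_lt degree_C_le (by norm_num), by simp⟩

theorem add {d : ℕ} {f g : ℝ → ℝ} (hf : IsPolyLT d f) (hg : IsPolyLT d g) :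
    IsPolyLT d fun y => f y + g y := by
  obtain ⟨p, hp, hfp⟩ := hf
  obtain ⟨q, hq, hgq⟩ := hg
  exact ⟨p + q, lt_of_le_of_lt (degree_add_le p q) (max_lt hp hq), by simp [hfp, hgq]⟩

theorem const_mul {d : ℕ} {f : ℝ → ℝ} (c : ℝ) (hf : IsPolyLT d f) :
    IsPolyLT d fun y => c * f y := by
  obtain ⟨p, hp, hfp⟩ := hf
  refine ⟨C c * p, lt_of_le_of_lt ?_ hp, by simp [hfp]⟩
  rw [← smul_eq_C_mul]
  exact degree_smul_le c p

theorem sum {d : ℕ} {ι : Type*} (s : Finset ι) {f : ι → ℝ → ℝ} (hf : ∀ i, IsPolyLT d (f i)) :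
    IsPolyLT d fun y => ∑ i ∈ s, f i y := by
  classical
  induction s using Finset.induction_on with
  | empty => simpa using zero d
  | insert a s ha ih => simpa [Finset.sum_insert ha] using (hf a).add ih

theorem mul {d e : ℕ} {f g : ℝ → ℝ} (hf : IsPolyLT d f) (hg : IsPolyLT (e + 1) g) :
    IsPolyLT (d + e) fun y => f y * g y := by
  obtain ⟨p, hp, hfp⟩ := hf
  obtain ⟨q, hq, hgq⟩ := hg
  refine ⟨p * q, ?_, by simp [hfp, hgq]⟩
  rw [← mem_degreeLT] at *
  rcases eq_or_ne p 0 with rfl | hp0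
  · simp
  rcases eq_or_ne q 0 with rfl | hq0
  · simp
  rw [mem_degreeLT, degree_eq_natDegree (mul_ne_zero hp0 hq0), natDegree_mul hp0 hq0]
  rw [mem_degreeLT, degree_eq_natDegree hp0] at hp
  rw [mem_degreeLT, degree_eq_natDegree hq0] at hq
  norm_cast at *
  omega

theorem sub_id (x : ℝ) : IsPolyLT 2 fun y => x - y :=
  ⟨C x - X, lt_of_le_of_lt (degree_sub_le _ _)
    (max_lt (lt_of_le_of_lt degree_C_le (by norm_num)) (by rw [degree_X]; norm_num)), by simp⟩

theorem one_sub_sub_id (x : ℝ) : IsPolyLT 2 fun y => 1 - (x - y) :=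
  ⟨C (1 - x) + X, lt_of_le_of_lt (degree_add_le _ _)
    (max_lt (lt_of_le_of_lt degree_C_le (by norm_num)) (by rw [degree_X]; norm_num)),
    fun y => by simp; ring⟩

theorem list_prod {ι : Type*} (l : List ι) {f : ι → ℝ → ℝ} {e : ℕ}
    (hf : ∀ i, IsPolyLT (e + 1) (f i)) :
    IsPolyLT (e * l.length + 1) fun y => (l.map fun i => f i y).prod := by
  induction l with
  | nil => simpa using const 1
  | cons a l ih =>
    have := ih.mul (hf a)
    simp only [List.map_cons, List.prod_cons, List.length_cons]
    convert this using 1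
    · ring
    · funext y; ring

theorem congr {d e : ℕ} {f : ℝ → ℝ} (hf : IsPolyLT d f) (h : d = e) : IsPolyLT e f := h ▸ hf

theorem mono {d e : ℕ} {f : ℝ → ℝ} (hf : IsPolyLT d f) (h : d ≤ e) : IsPolyLT e f := by
  obtain ⟨p, hp, hfp⟩ := hf
  exact ⟨p, lt_of_lt_of_le hp (by exact_mod_cast h), hfp⟩

theorem eq_of_card {d : ℕ} {f g : ℝ → ℝ} (hf : IsPolyLT d f) (hg : IsPolyLT d g) (s : Finset ℝ)
    (hs : d ≤ s.card) (h : ∀ y ∈ s, f y = g y) : f = g := by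
  obtain ⟨p, hp, hfp⟩ := hf
  obtain ⟨q, hq, hgq⟩ := hg
  have : p = q := Polynomial.eq_of_degrees_lt_of_eval_finset_eq s
    (lt_of_lt_of_le hp (by exact_mod_cast hs)) (lt_of_lt_of_le hq (by exact_mod_cast hs))
    fun y hy => by rw [← hfp, ← hgq, h y hy]
  funext y
  rw [hfp, hgq, this]

end IsPolyLT

theorem isPolyLT_partitionMatrix {N : ℕ} (y : Fin N → ℝ) (l : List ℝ) (s t : Fin N → Bool) :
    IsPolyLT l.length fun y₀ => partitionMatrix (Fin.cons y₀ y : Fin (N + 1) → ℝ) l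
      (Fin.cons false s) (Fin.cons true t) := by
  induction l generalizing s with
  | nil => simpa only [partitionMatrix_nil_false] using IsPolyLT.zero _
  | cons x l ih =>
    simp only [partitionMatrix_cons_false, List.length_cons]
    refine IsPolyLT.add ?_ ?_
    · have := (IsPolyLT.sum Finset.univ fun u => (ih u).const_mul
        (rowMatrix x y s u false true)).mul (e := 1) (IsPolyLT.sub_id x)
      simpa only [mul_comm] using this
    · have := (IsPolyLT.list_prod l (e := 1) fun z => IsPolyLT.one_sub_sub_id z).const_mul
        (∑ u, rowMatrix x y s u true true * partitionMatrix y l u t)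
      simpa only [mul_comm, one_mul, mul_one] using this

theorem isPolyLT_foldedPartition {N : ℕ} (y : Fin N → ℝ) (l : List ℝ) (s : Fin N → Bool × Bool) :
    IsPolyLT (2 * l.length) fun y₀ => foldedPartition (Fin.cons y₀ y : Fin (N + 1) → ℝ) l
      (Fin.cons (false, false) s) := by
  induction l generalizing s with
  | nil => simpa only [foldedPartition_nil_false_false] using IsPolyLT.zero _
  | cons x l ih =>
    simp only [foldedPartition_cons_false_false, List.length_cons]
    have ha := IsPolyLT.sub_id x
    have hb := IsPolyLT.one_sub_sub_id x
    have hA := IsPolyLT.list_prod l (e := 2) (f := fun z y => (z - y) ^ 2) fun z => by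
      simpa only [sq] using (IsPolyLT.sub_id z).mul (e := 1) (IsPolyLT.sub_id z)
    have hB := IsPolyLT.list_prod l (e := 2) (f := fun z y => (1 - (z - y)) ^ 2) fun z => by
      simpa only [sq] using (IsPolyLT.one_sub_sub_id z).mul (e := 1) (IsPolyLT.one_sub_sub_id z)
    refine IsPolyLT.add (IsPolyLT.add ?_ ?_) ?_
    · have := (IsPolyLT.sum Finset.univ fun u => (ih u).const_mul
        (foldedRowMatrix x y s u false true)).mul (e := 2) (ha.mul (e := 1) hb)
        |>.congr (show _ = 2 * (l.length + 1) by ring)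
      simpa only [mul_comm] using this
    · have := ((hB.mul (e := 1) hb).const_mul
        (∑ u, foldedRowMatrix x y s u true true * foldedPartition y l u)).congr
        (show _ = 2 * (l.length + 1) by ring)
      simpa only [mul_comm] using this
    · have := ((hA.mul (e := 1) ha).const_mul
        (∑ u, foldedRowMatrix x y s u false false * foldedPartition y l u)).congr
        (show _ = 2 * (l.length + 1) by ring)
      simpa only [mul_comm] using this

/-- No two members of `l` are equal or differ by `1`; then the numbers `x` and `x - 1` for `x` in
`l` are pairwise distinct. -/
def Separated (l : List ℝ) : Prop :=
  l.Pairwise fun a b => a ≠ b ∧ a ≠ b - 1 ∧ b ≠ a - 1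

theorem Separated.of_perm {l l' : List ℝ} (h : l.Perm l') (hl : Separated l) : Separated l' :=
  (h.pairwise_iff fun {_ _} hab => ⟨hab.1.symm, hab.2.2, hab.2.1⟩).1 hl

theorem card_separated {l : List ℝ} (hl : Separated l) :
    (l.toFinset ∪ (l.map fun x => x - 1).toFinset).card = 2 * l.length := by
  have hd : l.Nodup := hl.imp fun h => h.1
  have hd' : (l.map fun x => x - 1).Nodup := hd.map fun a b h => by linarith
  rw [Finset.card_union_of_disjoint, List.toFinset_card_of_nodup hd,
    List.toFinset_card_of_nodup hd', List.length_map, two_mul]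
  rw [Finset.disjoint_left]
  intro a ha ha'
  simp only [List.mem_toFinset, List.mem_map] at ha ha'
  obtain ⟨b, hb, rfl⟩ := ha'
  by_cases h : b - 1 = b
  · linarith
  · have : Std.Symm fun a b : ℝ => a ≠ b ∧ a ≠ b - 1 ∧ b ≠ a - 1 :=
      ⟨fun _ _ hab => ⟨hab.1.symm, hab.2.2, hab.2.1⟩⟩
    exact (List.Pairwise.forall hl ha hb h).2.1 rfl

/-- The half-turn symmetric partition function is the square of the domain wall partition
function. -/
theorem foldedPartition_eq_sq_of_separated {N : ℕ} (y : Fin N → ℝ) (l : List ℝ)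
    (hN : l.length = N) (hl : Separated l) :
    foldedPartition y l (fun _ => (false, false)) =
      partitionMatrix y l (fun _ => false) (fun _ => true) ^ 2 := by
  induction N generalizing l with
  | zero =>
    obtain rfl := List.length_eq_zero_iff.1 hN
    rw [Subsingleton.elim (fun _ : Fin 0 => true) fun _ => false]
    simp [foldedPartition, partitionMatrix, Matrix.one_apply, funext_iff]
  | succ N ih =>
    have hs : ∀ {α : Type} (a : α), (fun _ : Fin (N + 1) => a) = Fin.cons a fun _ => a := by
      intro α a
      exact (Fin.cons_self_tail fun _ : Fin (N + 1) => a).symm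
    have hf := isPolyLT_foldedPartition (Fin.tail y) l fun _ => (false, false)
    have hg := isPolyLT_partitionMatrix (Fin.tail y) l (fun _ => false) fun _ => true
    rw [hN] at hf hg
    have hg2 := hg.mul hg
    rw [← Fin.cons_self_tail y, hs, hs, hs, sq]
    refine congrFun (hf.eq_of_card (hg2.mono (by omega)) _
      (by rw [card_separated hl, hN]) ?_) (y 0)
    intro y₀ hy
    simp only [Finset.mem_union, List.mem_toFinset, List.mem_map] at hy
    have key : ∀ x ∈ l, (l.erase x).length = N ∧ Separated (l.erase x) := by
      intro x hx
      refine ⟨by rw [List.length_erase_of_mem hx, hN, Nat.add_sub_cancel], ?_⟩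
      exact (List.pairwise_cons.1 (hl.of_perm (List.perm_cons_erase hx))).2
    rcases hy with hx | ⟨x, hx, rfl⟩
    · have hp := List.perm_cons_erase hx
      rw [foldedPartition_perm _ hp, partitionMatrix_perm _ hp, foldedPartition_freeze_left,
        partitionMatrix_freeze_left, ih _ _ (key _ hx).1 (key _ hx).2,]
      simp only [sq, List.prod_map_mul, Finset.prod_mul_distrib]
      ring
    · have hp := List.perm_cons_erase hx
      have hp' := hp.trans (List.perm_append_singleton x (l.erase x)).symm
      have h1 : 1 - (x - (x - 1)) = 0 := by ring
      rw [foldedPartition_perm _ hp, partitionMatrix_perm _ hp',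
        foldedPartition_freeze_right _ _ h1, partitionMatrix_freeze_right _ _ h1,
        ih _ _ (key _ hx).1 (key _ hx).2]
      simp only [sq, List.prod_map_mul, Finset.prod_mul_distrib]
      ring

/-! ### Equal row parameters -/

theorem continuous_vertexMatrix (y : ℝ) (s t : Bool) :
    Continuous fun x => vertexMatrix (x - y) s t := by
  refine continuous_matrix fun h h' => ?_
  cases h <;> cases h' <;> cases s <;> cases t <;> simp only [vertexMatrix, vertexWeight,
    Matrix.of_apply] <;> fun_prop

theorem continuous_rowMatrix {N : ℕ} (y : Fin N → ℝ) (s t : Fin N → Bool) :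
    Continuous fun x => rowMatrix x y s t := by
  induction N with
  | zero => exact continuous_const
  | succ N ih => exact (continuous_vertexMatrix _ _ _).matrix_mul (ih _ _ _)

theorem continuous_foldedRowMatrix {N : ℕ} (y : Fin N → ℝ) (s t : Fin N → Bool × Bool) :
    Continuous fun x => foldedRowMatrix x y s t := by
  induction N with
  | zero => exact continuous_const
  | succ N ih =>
    exact ((continuous_vertexMatrix _ _ _).matrix_mul (ih _ _ _)).matrix_mul
      (continuous_vertexMatrix _ _ _)

theorem separated_perturbation (N : ℕ) (c ε : ℝ) (h0 : 0 < ε) (h1 : ε * N < 1) :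
    Separated ((List.finRange N).map fun i : Fin N => c + ε * ((i : ℕ) : ℝ)) := by
  rw [Separated, List.pairwise_map]
  refine (List.pairwise_lt_finRange N).imp fun {i j} hij => ?_
  have hij' : ((i : ℕ) : ℝ) + 1 ≤ (j : ℕ) := by exact_mod_cast hij
  have hj : ((j : ℕ) : ℝ) ≤ N := by exact_mod_cast j.2.le
  have hi : (0 : ℝ) ≤ (i : ℕ) := Nat.cast_nonneg _
  refine ⟨?_, ?_, ?_⟩ <;> intro h <;> nlinarith

theorem foldedPartition_eq_sq {N : ℕ} (y : Fin N → ℝ) (c : ℝ) :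
    foldedPartition y ((List.finRange N).map fun _ => c) (fun _ => (false, false)) =
      partitionMatrix y ((List.finRange N).map fun _ => c) (fun _ => false)
        (fun _ => true) ^ 2 := by
  set f : ℝ → ℝ := fun ε => foldedPartition y
    ((List.finRange N).map fun i : Fin N => c + ε * ((i : ℕ) : ℝ)) (fun _ => (false, false)) with hf
  set g : ℝ → ℝ := fun ε => partitionMatrix y
    ((List.finRange N).map fun i : Fin N => c + ε * ((i : ℕ) : ℝ)) (fun _ => false)
      (fun _ => true) ^ 2 with hg
  have hfc : Continuous f := by
    refine continuous_finsetSum _ fun t _ => Continuous.mul ?_ continuous_const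
    simp only [List.map_map]
    refine Continuous.matrix_elem (continuous_list_prod _ fun i _ => ?_) _ _
    refine continuous_matrix fun s s' => ?_
    exact ((continuous_foldedRowMatrix y s s').comp
      (by fun_prop : Continuous fun ε : ℝ => c + ε * ((i : ℕ) : ℝ))).matrix_elem _ _
  have hgc : Continuous g := by
    refine Continuous.pow ?_ 2
    simp only [partitionMatrix, List.map_map]
    refine Continuous.matrix_elem (continuous_list_prod _ fun i _ => ?_) _ _
    refine continuous_matrix fun s s' => ?_
    exact ((continuous_rowMatrix y s s').comp
      (by fun_prop : Continuous fun ε : ℝ => c + ε * ((i : ℕ) : ℝ))).matrix_elem _ _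
  have hev : f =ᶠ[nhdsWithin 0 (Set.Ioi 0)] g := by
    have hN : (0 : ℝ) < 1 / (N + 1) := by positivity
    filter_upwards [Ioo_mem_nhdsGT hN] with ε hε
    refine foldedPartition_eq_sq_of_separated _ _ (by simp) (separated_perturbation _ _ _ hε.1 ?_)
    have := hε.2
    rw [lt_div_iff₀ (by positivity)] at this
    nlinarith [hε.1]
  have := tendsto_nhds_unique ((hfc.tendsto 0).mono_left nhdsWithin_le_nhds)
    (((hgc.tendsto 0).mono_left nhdsWithin_le_nhds).congr' hev.symm)
  simpa [hf, hg] using this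

/-! ### Potentials of alternating lines -/

/-- The increment `b - a`, where `false` stands for `0` and `true` for `1`. -/
def boolDiff : Bool → Bool → SignType
  | false, true => 1
  | true, false => -1
  | _, _ => 0

theorem boolDiff_self (a : Bool) : boolDiff a a = 0 := by cases a <;> rfl

theorem boolDiff_ne_zero {a b : Bool} : boolDiff a b ≠ 0 ↔ a ≠ b := by
  cases a <;> cases b <;> decide

theorem boolDiff_left_inj {a b c : Bool} : boolDiff a b = boolDiff a c ↔ b = c := by
  cases a <;> cases b <;> cases c <;> decide

/-- `p` is the sequence of partial sums of `v`, all of which are `0` or `1`. -/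
def IsPotential {n : ℕ} (p : Fin (n + 1) → Bool) (v : Fin n → SignType) : Prop :=
  p 0 = false ∧ ∀ i, v i = boolDiff (p i.castSucc) (p i.succ)

theorem IsPotential.unique {n : ℕ} {p q : Fin (n + 1) → Bool} {v : Fin n → SignType}
    (hp : IsPotential p v) (hq : IsPotential q v) : p = q := by
  funext i
  induction i using Fin.induction with
  | zero => rw [hp.1, hq.1]
  | succ i ih =>
    have h := (hp.2 i).symm.trans (hq.2 i)
    rw [ih] at h
    exact boolDiff_left_inj.1 h

theorem IsPotential.eq_of_forall_eq_zero {n : ℕ} {p : Fin (n + 1) → Bool} {v : Fin n → SignType}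
    (hp : IsPotential p v) {a : Fin (n + 1)} (b : Fin (n + 1)) (hab : a ≤ b)
    (h : ∀ k : Fin n, a ≤ k.castSucc → k.castSucc < b → v k = 0) : p a = p b := by
  induction b using Fin.induction with
  | zero => rw [Fin.le_zero_iff.1 hab]
  | succ i ih =>
    rcases hab.eq_or_lt with rfl | hlt
    · rfl
    · have hle : a ≤ i.castSucc := Fin.le_castSucc_iff.2 hlt
      rw [ih hle fun k h1 h2 => h k h1 (h2.trans i.castSucc_lt_succ)]
      have h0 := h i hle i.castSucc_lt_succ
      rw [hp.2 i] at h0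
      by_contra hne
      exact boolDiff_ne_zero.2 hne h0

theorem IsPotential.eq_true_iff {n : ℕ} {p : Fin (n + 1) → Bool} {v : Fin n → SignType}
    (hp : IsPotential p v) (hv : ∀ i, v i ≠ -1) (k : Fin (n + 1)) :
    p k = true ↔ ∃ i : Fin n, i.castSucc < k ∧ v i = 1 := by
  induction k using Fin.induction with
  | zero => simp [hp.1]
  | succ k ih =>
    have hk := hp.2 k
    have hvk := hv k
    have : (∃ i : Fin n, i.castSucc < k.succ ∧ v i = 1) ↔
        (∃ i : Fin n, i.castSucc < k.castSucc ∧ v i = 1) ∨ v k = 1 := by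
      constructor
      · rintro ⟨i, hi, h⟩
        rcases (Fin.le_castSucc_iff.2 hi).lt_or_eq with h' | h'
        · exact Or.inl ⟨i, h', h⟩
        · rw [Fin.castSucc_inj] at h'
          exact Or.inr (h' ▸ h)
      · rintro (⟨i, hi, h⟩ | h)
        · exact ⟨i, hi.trans k.castSucc_lt_succ, h⟩
        · exact ⟨k, k.castSucc_lt_succ, h⟩
    rw [this, ← ih]
    rw [hk] at hvk ⊢
    cases h1 : p k.castSucc <;> cases h2 : p k.succ <;> simp [boolDiff, h1, h2] at hvk ⊢

/-- A sequence is alternating if and only if all its partial sums are `0` or `1` and its sum is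
`1`. -/
theorem isAlternatingLine_iff {n : ℕ} {v : Fin n → SignType} :
    IsAlternatingLine v ↔ ∃ p : Fin (n + 1) → Bool, IsPotential p v ∧ p (Fin.last n) = true := by
  classical
  constructor
  · intro hv
    -- the partial sum before `k` is `1` when the last nonzero entry before `k` is `1`
    let Q : Fin (n + 1) → Prop := fun k =>
      ∃ i : Fin n, i.castSucc < k ∧ v i = 1 ∧ ∀ j, i < j → j.castSucc < k → v j = 0
    -- the last nonzero entry before a given place
    have hmax : ∀ k : Fin (n + 1), (∃ i : Fin n, i.castSucc < k ∧ v i ≠ 0) →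
        ∃ i : Fin n, i.castSucc < k ∧ v i ≠ 0 ∧ ∀ j, i < j → j.castSucc < k → v j = 0 := by
      rintro k ⟨i, hi, hvi⟩
      obtain ⟨m, hm, hmax⟩ := (Finset.univ.filter fun i : Fin n => i.castSucc < k ∧ v i ≠ 0)
        |>.exists_max_image id ⟨i, by simp [hi, hvi]⟩
      simp only [Finset.mem_filter, Finset.mem_univ, true_and, id] at hm hmax
      refine ⟨m, hm.1, hm.2, fun j hj hjk => ?_⟩
      by_contra h
      exact absurd (hmax j ⟨hjk, h⟩) (not_le.2 hj)
    refine ⟨fun k => decide (Q k), ⟨by simp [Q], fun i => ?_⟩, ?_⟩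
    · rcases h : v i with _ | _ | _
      · -- a zero entry
        have : Q i.castSucc ↔ Q i.succ := by
          constructor
          · rintro ⟨j, hj, hvj, hz⟩
            refine ⟨j, hj.trans i.castSucc_lt_succ, hvj, fun k hk hki => ?_⟩
            rcases (Fin.le_castSucc_iff.2 hki).lt_or_eq with h' | h'
            · exact hz k hk h'
            · rw [Fin.castSucc_inj] at h'
              rw [h']; exact h
          · rintro ⟨j, hj, hvj, hz⟩
            rcases (Fin.le_castSucc_iff.2 hj).lt_or_eq with h' | h'
            · exact ⟨j, h', hvj, fun k hk hki => hz k hk (hki.trans i.castSucc_lt_succ)⟩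
            · rw [Fin.castSucc_inj] at h'
              rw [h', h] at hvj
              exact absurd hvj (by decide)
        simp only [this, boolDiff_self]
        rfl
      · have h1 : Q i.castSucc := by
          by_cases hex : ∃ j : Fin n, j.castSucc < i.castSucc ∧ v j ≠ 0
          · obtain ⟨j, hj, hvj, hz⟩ := hmax _ hex
            refine ⟨j, hj, ?_, hz⟩
            have := hv.alternate j i hj hvj (by rw [h]; decide) fun k h1 h2 => hz k h1 h2
            rw [h] at this
            have h' := congrArg Neg.neg this
            rw [neg_neg] at h'
            rw [← h']; rfl
          · push Not at hex
            have := hv.first_eq_one i (by rw [h]; decide) fun j hj => hex j hj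
            rw [h] at this
            exact absurd this (by decide)
        have h2 : ¬ Q i.succ := by
          rintro ⟨j, hj, hvj, hz⟩
          rcases (Fin.le_castSucc_iff.2 hj).lt_or_eq with h' | h'
          · have := hz i h' i.castSucc_lt_succ
            rw [h] at this
            exact absurd this (by decide)
          · rw [Fin.castSucc_inj] at h'
            rw [h', h] at hvj
            exact absurd hvj (by decide)
        simp only [h1, h2, decide_true, decide_false]
        rfl
      · have h1 : ¬ Q i.castSucc := by
          rintro ⟨j, hj, hvj, hz⟩
          have := hv.alternate j i hj (by rw [hvj]; decide) (by rw [h]; decide)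
            fun k h1 h2 => hz k h1 h2
          rw [h, hvj] at this
          exact absurd this (by decide)
        have h2 : Q i.succ :=
          ⟨i, i.castSucc_lt_succ, h, fun j hj hji =>
            absurd (Fin.le_castSucc_iff.2 hji) (not_le.2 hj)⟩
        simp only [h1, h2, decide_true, decide_false]
        rfl
    · obtain ⟨i₀, hi₀⟩ := hv.exists_ne_zero
      obtain ⟨i, hi, hvi, hz⟩ := hmax (Fin.last n) ⟨i₀, Fin.castSucc_lt_last _, hi₀⟩
      exact decide_eq_true
        ⟨i, hi, hv.last_eq_one i hvi fun j hj => hz j hj (Fin.castSucc_lt_last _), hz⟩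
  · rintro ⟨p, hp, hlast⟩
    refine ⟨?_, ?_, ?_, ?_⟩
    · by_contra! h
      have := hp.eq_of_forall_eq_zero (Fin.last n) (Fin.zero_le _) fun k _ _ => h k
      rw [hp.1, hlast] at this
      exact absurd this (by decide)
    · intro i hi h
      have := hp.eq_of_forall_eq_zero i.castSucc (Fin.zero_le _) fun k _ hk => h k hk
      rw [hp.2 i, ← this, hp.1] at hi ⊢
      cases h' : p i.succ <;> simp_all [boolDiff]
    · intro i hi h
      have := hp.eq_of_forall_eq_zero (a := i.succ) (Fin.last n) (Fin.le_last _)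
        fun k hk _ => h k (Fin.castSucc_lt_castSucc_iff.1 (i.castSucc_lt_succ.trans_le hk))
      rw [hp.2 i, this, hlast] at hi ⊢
      cases h' : p i.castSucc <;> simp_all [boolDiff]
    · intro i j hij hi hj h
      have := hp.eq_of_forall_eq_zero (a := i.succ) j.castSucc (Fin.succ_le_castSucc_iff.2 hij)
        fun k hk hkj => h k (Fin.castSucc_lt_castSucc_iff.1 (i.castSucc_lt_succ.trans_le hk)) hkj
      rw [hp.2 i] at hi ⊢
      rw [hp.2 j] at hj ⊢
      rw [← this] at hj ⊢
      cases h1 : p i.castSucc <;> cases h2 : p i.succ <;> cases h3 : p j.succ <;>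
        simp_all [boolDiff]

/-! ### Path expansions -/

theorem list_prod_apply_eq_sum_paths {ι R : Type*} [Fintype ι] [DecidableEq ι] [CommSemiring R]
    {n : ℕ} (A : Fin n → Matrix ι ι R) (a b : ι) :
    ((List.finRange n).map A).prod a b =
      ∑ p : Fin (n + 1) → ι with p 0 = a ∧ p (Fin.last n) = b,
        ∏ i, A i (p i.castSucc) (p i.succ) := by
  induction n generalizing a with
  | zero =>
    rw [Finset.sum_filter, sum_fin_succ_fun]
    by_cases h : a = b <;> simp [h, ite_and, Fin.last]
  | succ n ih =>
    rw [Finset.sum_filter, sum_fin_succ_fun, List.finRange_succ, List.map_cons, List.prod_cons,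
      List.map_map, Matrix.mul_apply]
    have := ih fun i => A i.succ
    simp only [Function.comp_def, this, Finset.mul_sum, Finset.sum_filter]
    rw [Finset.sum_comm, Finset.sum_comm (s := Finset.univ (α := ι))]
    refine Finset.sum_congr rfl fun p _ => ?_
    simp only [ite_and, mul_ite, mul_zero, Finset.sum_ite_eq, Finset.sum_ite_eq', Finset.mem_univ,
      if_true, Fin.cons_zero, Fin.prod_univ_succ, Fin.castSucc_zero, ← Fin.succ_last,
      Fin.cons_succ, ← Fin.succ_castSucc]

theorem rowMatrix_eq_prod (x : ℝ) {N : ℕ} (y : Fin N → ℝ) (s t : Fin N → Bool) :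
    rowMatrix x y s t =
      ((List.finRange N).map fun j => vertexMatrix (x - y j) (s j) (t j)).prod := by
  induction N with
  | zero => simp [rowMatrix]
  | succ N ih =>
    rw [rowMatrix, ih, List.finRange_succ, List.map_cons, List.prod_cons, List.map_map]
    rfl

theorem foldedRowMatrix_eq_prod (x : ℝ) {N : ℕ} (y : Fin N → ℝ) (s t : Fin N → Bool × Bool) :
    foldedRowMatrix x y s t =
      ((List.finRange N).map fun j => vertexMatrix (x - y j) (s j).1 (t j).1).prod *
      ((List.finRange N).reverse.map fun j => vertexMatrix (x - y j) (s j).2 (t j).2).prod := by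
  induction N with
  | zero => simp [foldedRowMatrix]
  | succ N ih =>
    rw [foldedRowMatrix, ih, List.finRange_succ, List.map_cons, List.prod_cons, List.map_map,
      List.reverse_cons, List.map_append, List.prod_append, ← List.map_reverse]
    simp only [Function.comp_def, Fin.tail, List.map_map, List.map_cons, List.map_nil,
      List.prod_cons, List.prod_nil, mul_one, mul_assoc]

/-! ### Ice configurations and alternating-sign matrices -/

/-- `σ` gives the vertical and `P` the horizontal edges of a six-vertex configuration with `n` rows
and `N` columns: all edges at the top and at the left carry `0`, those at the right carry `1`, and
the increments across each vertex agree. The edges at the bottom are free. -/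
structure IsIceConfig {n N : ℕ} (σ : Fin (n + 1) → Fin N → Bool)
    (P : Fin n → Fin (N + 1) → Bool) : Prop where
  top : ∀ j, σ 0 j = false
  left : ∀ i, P i 0 = false
  right : ∀ i, P i (Fin.last N) = true
  ice : ∀ i j, boolDiff (P i j.castSucc) (P i j.succ) = boolDiff (σ i.castSucc j) (σ i.succ j)

/-- The sign matrix of a configuration, whose partial row sums are given by `P`. -/
def signMatrix {n N : ℕ} (P : Fin n → Fin (N + 1) → Bool) : Matrix (Fin n) (Fin N) SignType :=
  fun i j => boolDiff (P i j.castSucc) (P i j.succ)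

theorem IsIceConfig.isPotential_row {n N : ℕ} {σ : Fin (n + 1) → Fin N → Bool}
    {P : Fin n → Fin (N + 1) → Bool} (h : IsIceConfig σ P) (i : Fin n) :
    IsPotential (P i) (signMatrix P i) :=
  ⟨h.left i, fun _ => rfl⟩

theorem IsIceConfig.isPotential_col {n N : ℕ} {σ : Fin (n + 1) → Fin N → Bool}
    {P : Fin n → Fin (N + 1) → Bool} (h : IsIceConfig σ P) (j : Fin N) :
    IsPotential (fun k => σ k j) (fun i => signMatrix P i j) :=
  ⟨h.top j, fun i => h.ice i j⟩

theorem vertexWeight_eq_zero (w : ℝ) {h s h' s' : Bool} (hne : boolDiff h h' ≠ boolDiff s s') :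
    vertexWeight w h s h' s' = 0 := by
  cases h <;> cases s <;> cases h' <;> cases s' <;> simp_all [boolDiff, vertexWeight]

theorem rowMatrix_eq_sum (x : ℝ) {N : ℕ} (y : Fin N → ℝ) (s t : Fin N → Bool) (a b : Bool) :
    rowMatrix x y s t a b = ∑ p : Fin (N + 1) → Bool with p 0 = a ∧ p (Fin.last N) = b,
      ∏ j, vertexWeight (x - y j) (p j.castSucc) (s j) (p j.succ) (t j) := by
  rw [rowMatrix_eq_prod, list_prod_apply_eq_sum_paths]
  rfl

open Classical in
/-- The partition function as a sum over ice configurations whose bottom edges satisfy `Q`; edge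
assignments that violate the ice rule have weight `0`. -/
theorem sum_partitionMatrix_eq {n N : ℕ} (y : Fin N → ℝ) (c : ℝ) (Q : (Fin N → Bool) → Prop) :
    (∑ t, partitionMatrix y ((List.finRange n).map fun _ => c) (fun _ => false) t *
      if Q t then 1 else 0) =
    ∑ q : (Fin (n + 1) → Fin N → Bool) × (Fin n → Fin (N + 1) → Bool) with
        IsIceConfig q.1 q.2 ∧ Q (q.1 (Fin.last n)),
      ∏ i, ∏ j, vertexWeight (c - y j) (q.2 i j.castSucc) (q.1 i.castSucc j) (q.2 i j.succ)
        (q.1 i.succ j) := by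
  have h1 : ∀ t, partitionMatrix y ((List.finRange n).map fun _ => c) (fun _ => false) t =
      ∑ σ : Fin (n + 1) → Fin N → Bool with σ 0 = (fun _ => false) ∧ σ (Fin.last n) = t,
        ∑ P : Fin n → Fin (N + 1) → Bool with ∀ i, P i 0 = false ∧ P i (Fin.last N) = true,
          ∏ i, ∏ j, vertexWeight (c - y j) (P i j.castSucc) (σ i.castSucc j) (P i j.succ)
            (σ i.succ j) := by
    intro t
    rw [partitionMatrix, List.map_map]
    simp only [Function.comp_def]
    rw [list_prod_apply_eq_sum_paths]
    refine Finset.sum_congr (by congr) fun σ _ => ?_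
    simp only [transfer, Matrix.of_apply, rowMatrix_eq_sum]
    rw [Finset.prod_univ_sum]
    refine Finset.sum_congr ?_ fun _ _ => rfl
    ext P
    simp [Fintype.mem_piFinset]
  simp only [h1, Finset.sum_filter, Fintype.sum_prod_type, Finset.sum_mul]
  rw [Finset.sum_comm]
  refine Finset.sum_congr rfl fun σ _ => ?_
  rw [Finset.sum_eq_single (σ (Fin.last n)) (fun t _ ht => by simp [ht.symm]) (by simp)]
  by_cases h0 : σ 0 = fun _ => false
  · by_cases hQ : Q (σ (Fin.last n))
    · simp only [h0, hQ, and_true, if_true, mul_one]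
      refine Finset.sum_congr rfl fun P _ => ?_
      by_cases hP : IsIceConfig σ P
      · rw [if_pos hP, if_pos fun i => ⟨hP.left i, hP.right i⟩]
      · rw [if_neg hP]
        split_ifs with hb
        · by_contra hne
          refine hP ⟨fun j => congrFun h0 j, fun i => (hb i).1, fun i => (hb i).2, fun i j => ?_⟩
          by_contra hij
          exact hne (Finset.prod_eq_zero (Finset.mem_univ i)
            (Finset.prod_eq_zero (Finset.mem_univ j) (vertexWeight_eq_zero _ hij)))
        · rfl
    · simp [hQ]
  · have : ∀ P, ¬ IsIceConfig σ P := fun P hP => h0 (funext hP.top)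
    simp [h0, this]

/-- The ratio of the vertex weight at `w` to the vertex weight at `1 / 2`. -/
def tilt (w : ℝ) (h s h' : Bool) : ℝ :=
  if h = h' then (if h = s then 2 * w else 2 * (1 - w)) else 1

theorem tilt_half (h s h' : Bool) : tilt (1 / 2) h s h' = 1 := by
  unfold tilt; split_ifs <;> norm_num

/-- At `w = 1 / 2` an entry `m` has weight `2 ^ (m - 1)`, times `4` if `m = -1`. The power of `2` is
written here as a quotient that telescopes along a row. -/
theorem vertexWeight_eq_mul_tilt (w : ℝ) {h s h' s' : Bool}
    (hice : boolDiff h h' = boolDiff s s') :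
    vertexWeight w h s h' s' * (if h then 2 else 1) =
      1 / 2 * (if h' then 2 else 1) * (if boolDiff h h' = -1 then 4 else 1) * tilt w h s h' := by
  cases h <;> cases s <;> cases h' <;> cases s' <;>
    simp_all [boolDiff, vertexWeight, tilt] <;> ring

theorem IsIceConfig.prod_row_vertexWeight {n N : ℕ} {σ : Fin (n + 1) → Fin N → Bool}
    {P : Fin n → Fin (N + 1) → Bool} (h : IsIceConfig σ P) (w : Fin N → ℝ) (i : Fin n) :
    ∏ j, vertexWeight (w j) (P i j.castSucc) (σ i.castSucc j) (P i j.succ) (σ i.succ j) =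
      (1 / 2) ^ N * 2 * 4 ^ (Finset.univ.filter fun j => signMatrix P i j = -1).card *
        ∏ j, tilt (w j) (P i j.castSucc) (σ i.castSucc j) (P i j.succ) := by
  have h1 : (∏ j : Fin N, if P i j.succ then (2 : ℝ) else 1) =
      (∏ j : Fin N, if P i j.castSucc then (2 : ℝ) else 1) * 2 := by
    have e1 := Fin.prod_univ_succ fun k => if P i k then (2 : ℝ) else 1
    have e2 := Fin.prod_univ_castSucc fun k => if P i k then (2 : ℝ) else 1
    simp only [h.left, h.right, if_true, Bool.false_eq_true, if_false, one_mul] at e1 e2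
    rw [← e1, e2]
  have h2 : (∏ j : Fin N, if P i j.castSucc then (2 : ℝ) else 1) ≠ 0 := by
    rw [Finset.prod_ne_zero_iff]
    intro j _
    split_ifs <;> norm_num
  have h3 : (∏ j : Fin N, if boolDiff (P i j.castSucc) (P i j.succ) = -1 then (4 : ℝ) else 1) =
      4 ^ (Finset.univ.filter fun j => signMatrix P i j = -1).card := by
    change (∏ j, if signMatrix P i j = -1 then (4 : ℝ) else 1) = _
    rw [Finset.prod_ite]; simp
  refine mul_right_cancel₀ h2 ?_
  rw [← Finset.prod_mul_distrib,
    Finset.prod_congr rfl fun j _ => vertexWeight_eq_mul_tilt (w j) (h.ice i j)]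
  simp only [Finset.prod_mul_distrib, h1, h3, Finset.prod_const, Finset.card_univ,
    Fintype.card_fin]
  ring

theorem IsIceConfig.prod_vertexWeight {n N : ℕ} {σ : Fin (n + 1) → Fin N → Bool}
    {P : Fin n → Fin (N + 1) → Bool} (h : IsIceConfig σ P) (w : Fin N → ℝ) :
    ∏ i, ∏ j, vertexWeight (w j) (P i j.castSucc) (σ i.castSucc j) (P i j.succ) (σ i.succ j) =
      ((1 / 2) ^ N * 2) ^ n *
        4 ^ (∑ i, (Finset.univ.filter fun j => signMatrix P i j = -1).card) *
        ∏ j, ∏ i, tilt (w j) (P i j.castSucc) (σ i.castSucc j) (P i j.succ) := by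
  rw [Finset.prod_congr rfl fun i _ => h.prod_row_vertexWeight w i, Finset.prod_mul_distrib,
    Finset.prod_mul_distrib, Finset.prod_pow_eq_pow_sum, Finset.prod_comm]
  simp

theorem prod_ite_lt_eq {n : ℕ} (r : Fin n) (a b : ℝ) :
    (∏ i : Fin n, if i < r then a else if i = r then 1 else b) =
      a ^ (r : ℕ) * b ^ (n - 1 - r : ℕ) := by
  have : ∀ i : Fin n, (if i < r then a else if i = r then 1 else b) =
      (if i < r then a else 1) * (if r < i then b else 1) := by
    intro i
    rcases lt_trichotomy i r with h | h | h
    · simp [h, h.not_gt]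
    · simp [h]
    · simp [h, h.not_gt, h.ne']
  simp only [this, Finset.prod_mul_distrib, Finset.prod_ite, Finset.prod_const, one_pow, mul_one]
  rw [Finset.filter_gt_eq_Iio, Finset.filter_lt_eq_Ioi, Fin.card_Iio, Fin.card_Ioi]

theorem IsPotential.eq_of_eq_one {n : ℕ} {p : Fin (n + 1) → Bool} {v : Fin n → SignType}
    (hp : IsPotential p v) (hv : ∀ i, v i ≠ -1) {r s : Fin n} (hr : v r = 1) (hs : v s = 1) :
    r = s := by
  have key : ∀ r s : Fin n, v r = 1 → v s = 1 → ¬ r < s := by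
    intro r s hr hs hlt
    have h1 := (hp.eq_true_iff hv s.castSucc).2 ⟨r, Fin.castSucc_lt_castSucc_iff.2 hlt, hr⟩
    rw [hp.2 s, h1] at hs
    cases h : p s.succ <;> rw [h] at hs <;> exact absurd hs (by decide)
  exact le_antisymm (not_lt.1 (key s r hs hr)) (not_lt.1 (key r s hr hs))

theorem numNegOnes_eq_sum {n : ℕ} (M : Matrix (Fin n) (Fin n) SignType) :
    numNegOnes M = ∑ i, (Finset.univ.filter fun j => M i j = -1).card := by
  simp only [numNegOnes, Finset.card_filter, Fintype.sum_prod_type]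

open Classical in
theorem refinedCount_sum_eq {n : ℕ} [NeZero n] (f : Fin n → ℝ) (x : ℝ) :
    ∑ r, refinedCount n r x * f r =
      ∑ M : Matrix (Fin n) (Fin n) SignType with IsASM M,
        ∑ r, if M r 0 = 1 then x ^ numNegOnes M * f r else 0 := by
  rw [Finset.sum_comm]
  refine Finset.sum_congr rfl fun r _ => ?_
  rw [refinedCount, Finset.sum_mul, Finset.sum_filter, Finset.sum_filter]
  refine Finset.sum_congr rfl fun M _ => ?_
  rw [ite_and]
  rfl

/-- With a special first column and weight `1 / 2` elsewhere, the domain wall partition function is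
the refined enumeration, homogenized in `2 * w` and `2 * (1 - w)`. -/
theorem partitionMatrix_eq_refinedCount (m : ℕ) (w : ℝ) :
    partitionMatrix (Fin.cons (1 / 2 - w) fun _ => 0 : Fin (m + 1) → ℝ)
        ((List.finRange (m + 1)).map fun _ => 1 / 2) (fun _ => false) (fun _ => true) =
      ((1 / 2) ^ (m + 1) * 2) ^ (m + 1) * ∑ r : Fin (m + 1), refinedCount (m + 1) r (4 : ℝ) *
        ((2 * w) ^ (r : ℕ) * (2 * (1 - w)) ^ (m + 1 - 1 - r : ℕ)) := by
  classical
  have h := sum_partitionMatrix_eq (n := m + 1)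
    (Fin.cons (1 / 2 - w) fun _ => 0 : Fin (m + 1) → ℝ) (1 / 2) (fun t => t = fun _ => true)
  simp only [mul_ite, mul_one, mul_zero, Finset.sum_ite_eq', Finset.mem_univ, if_true] at h
  rw [h, refinedCount_sum_eq, Finset.mul_sum]
  refine Finset.sum_bij (fun q _ => signMatrix q.2) ?_ ?_ ?_ ?_
  · rintro ⟨σ, P⟩ hq
    simp only [Finset.mem_filter, Finset.mem_univ, true_and] at hq ⊢
    exact ⟨fun i => isAlternatingLine_iff.2 ⟨P i, hq.1.isPotential_row i, hq.1.right i⟩,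
      fun j => isAlternatingLine_iff.2 ⟨_, hq.1.isPotential_col j, congrFun hq.2 j⟩⟩
  · rintro ⟨σ, P⟩ hq ⟨σ', P'⟩ hq' he
    simp only [Finset.mem_filter, Finset.mem_univ, true_and] at hq hq' he
    have hP : P = P' := funext fun i =>
      (hq.1.isPotential_row i).unique (he ▸ hq'.1.isPotential_row i)
    have hσ : ∀ j, (fun k => σ k j) = fun k => σ' k j := fun j =>
      (hq.1.isPotential_col j).unique (he ▸ hq'.1.isPotential_col j)
    rw [hP, show σ = σ' from funext fun k => funext fun j => congrFun (hσ j) k]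
  · intro M hM
    simp only [Finset.mem_filter, Finset.mem_univ, true_and] at hM
    choose P hP hPl using fun i => isAlternatingLine_iff.1 (hM.row i)
    choose S hS hSl using fun j => isAlternatingLine_iff.1 (hM.col j)
    have hMP : signMatrix P = M := by
      ext i j
      exact ((hP i).2 j).symm
    refine ⟨(fun k j => S j k, P), ?_, hMP⟩
    simp only [Finset.mem_filter, Finset.mem_univ, true_and]
    exact ⟨⟨fun j => (hS j).1, fun i => (hP i).1, hPl,
      fun i j => ((hP i).2 j).symm.trans ((hS j).2 i)⟩, funext hSl⟩
  · rintro ⟨σ, P⟩ hq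
    simp only [Finset.mem_filter, Finset.mem_univ, true_and] at hq
    obtain ⟨hc, hl⟩ := hq
    have hcol := hc.isPotential_col 0
    have hv : ∀ i, signMatrix P i 0 ≠ -1 := by
      intro i
      simp only [signMatrix, Fin.castSucc_zero, hc.left]
      cases P i (Fin.succ 0) <;> decide
    obtain ⟨r, -, hr⟩ := (hcol.eq_true_iff hv (Fin.last _)).1 (congrFun hl 0)
    rw [hc.prod_vertexWeight fun j => 1 / 2 -
      (Fin.cons (1 / 2 - w) fun _ => 0 : Fin (m + 1) → ℝ) j, Finset.sum_eq_single r
      (fun s _ hs => if_neg fun h => hs (hcol.eq_of_eq_one hv h hr)) (by simp), if_pos hr,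
      Fin.prod_univ_succ, numNegOnes_eq_sum, ← prod_ite_lt_eq]
    simp only [Fin.cons_succ, sub_zero, tilt_half, Finset.prod_const_one, mul_one, Fin.cons_zero,
      sub_sub_cancel]
    rw [mul_assoc]
    congr 2
    refine Finset.prod_congr rfl fun i _ => ?_
    have hs := hcol.eq_true_iff hv i.castSucc
    have hs' : σ i.castSucc 0 = true ↔ r < i := by
      rw [hs]
      constructor
      · rintro ⟨k, hk, hk1⟩
        rw [hcol.eq_of_eq_one hv hr hk1]
        exact hk
      · exact fun h => ⟨r, h, hr⟩
    have hi : P i (Fin.succ 0) = true ↔ i = r := by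
      have : signMatrix P i 0 = 1 ↔ P i (Fin.succ 0) = true := by
        simp only [signMatrix, Fin.castSucc_zero, hc.left]
        cases P i (Fin.succ 0) <;> decide
      rw [← this]
      exact ⟨fun h => hcol.eq_of_eq_one hv h hr, fun h => h ▸ hr⟩
    rw [Fin.castSucc_zero, hc.left, tilt]
    rcases lt_trichotomy i r with h | h | h
    · have e1 : P i (Fin.succ 0) = false := by
        rw [← Bool.not_eq_true, hi]; exact h.ne
      have e2 : σ i.castSucc 0 = false := by
        rw [← Bool.not_eq_true, hs']; exact h.not_gt
      rw [e1, e2, if_pos rfl, if_pos rfl, if_pos h]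
    · rw [hi.2 h, if_neg (by decide), if_neg h.not_lt, if_pos h]
    · have e1 : P i (Fin.succ 0) = false := by
        rw [← Bool.not_eq_true, hi]; exact h.ne'
      rw [e1, hs'.2 h, if_pos rfl, if_neg (by decide), if_neg h.not_gt, if_neg h.ne']

/-! ### Unfolding and half-turn symmetric matrices -/

/-- The index `j` in the first half of `Fin (2 * N)`. -/
def lowerIdx {N : ℕ} (j : Fin N) : Fin (2 * N) := ⟨j, by omega⟩

/-- The mirror image in `Fin (2 * N)` of the index `j` in the first half. -/
def upperIdx {N : ℕ} (j : Fin N) : Fin (2 * N) := ⟨2 * N - 1 - j, by omega⟩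

theorem rev_lowerIdx {N : ℕ} (j : Fin N) : (lowerIdx j).rev = upperIdx j := by
  ext; simp only [lowerIdx, upperIdx, Fin.val_rev]; omega

theorem rev_upperIdx {N : ℕ} (j : Fin N) : (upperIdx j).rev = lowerIdx j := by
  rw [← rev_lowerIdx, Fin.rev_rev]

theorem exists_lowerIdx_or_upperIdx {N : ℕ} (i : Fin (2 * N)) :
    (∃ j : Fin N, i = lowerIdx j) ∨ ∃ j : Fin N, i = upperIdx j := by
  by_cases h : (i : ℕ) < N
  · exact Or.inl ⟨⟨i, h⟩, rfl⟩
  · refine Or.inr ⟨⟨2 * N - 1 - i, by omega⟩, ?_⟩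
    ext; simp only [upperIdx]; omega

theorem finRange_two_mul (N : ℕ) :
    List.finRange (2 * N) =
      (List.finRange N).map lowerIdx ++ (List.finRange N).reverse.map upperIdx := by
  refine List.ext_getElem (by simp; omega) fun i h1 h2 => ?_
  rw [List.getElem_append]
  split_ifs with h
  · ext; simp [lowerIdx]
  · ext
    simp only [List.length_map, List.length_finRange] at h h1
    simp [upperIdx]
    omega

@[to_additive]
theorem prod_univ_double {M : Type*} [CommMonoid M] {N : ℕ} (f : Fin (2 * N) → M) :
    ∏ j, f j = ∏ j : Fin N, f (lowerIdx j) * f (upperIdx j) := by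
  rw [← List.prod_ofFn, List.ofFn_eq_map, finRange_two_mul, List.map_append, List.prod_append,
    List.map_reverse, List.map_reverse, List.prod_reverse, List.map_map, List.map_map,
    ← List.ofFn_eq_map, ← List.ofFn_eq_map, List.prod_ofFn, List.prod_ofFn,
    Finset.prod_mul_distrib]
  rfl

/-- The sequence of length `2N` whose entries at `j` and at its mirror image form the pair `s j`. -/
def unfoldPairs {β : Type*} {N : ℕ} (s : Fin N → β × β) : Fin (2 * N) → β := fun j =>
  if h : (j : ℕ) < N then (s ⟨j, h⟩).1 else (s ⟨2 * N - 1 - j, by omega⟩).2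

@[simp]
theorem unfoldPairs_lowerIdx {β : Type*} {N : ℕ} (s : Fin N → β × β) (j : Fin N) :
    unfoldPairs s (lowerIdx j) = (s j).1 := by
  simp [unfoldPairs, lowerIdx]

@[simp]
theorem unfoldPairs_upperIdx {β : Type*} {N : ℕ} (s : Fin N → β × β) (j : Fin N) :
    unfoldPairs s (upperIdx j) = (s j).2 := by
  have h1 : ¬ (2 * N - 1 - (j : ℕ) < N) := by omega
  have h2 : 2 * N - 1 - (2 * N - 1 - (j : ℕ)) = j := by omega
  simp [unfoldPairs, upperIdx, h1, h2]

/-- Unfolding of pairs as a bijection. -/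
def unfoldEquiv (β : Type*) (N : ℕ) : (Fin N → β × β) ≃ (Fin (2 * N) → β) where
  toFun := unfoldPairs
  invFun t := fun j => (t (lowerIdx j), t (upperIdx j))
  left_inv s := by ext j <;> simp
  right_inv t := by
    funext i
    rcases exists_lowerIdx_or_upperIdx i with ⟨j, rfl⟩ | ⟨j, rfl⟩ <;> simp

theorem foldedRowMatrix_eq_rowMatrix (x : ℝ) {N : ℕ} (y : Fin N → ℝ) (s t : Fin N → Bool × Bool) :
    foldedRowMatrix x y s t =
      rowMatrix x (unfoldPairs fun j => (y j, y j)) (unfoldPairs s) (unfoldPairs t) := by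
  rw [foldedRowMatrix_eq_prod, rowMatrix_eq_prod, finRange_two_mul, List.map_append,
    List.prod_append, List.map_map, List.map_map]
  simp only [Function.comp_def, unfoldPairs_lowerIdx, unfoldPairs_upperIdx]

theorem prod_transfer_foldedRowMatrix {N : ℕ} (y : Fin N → ℝ) (l : List ℝ)
    (s t : Fin N → Bool × Bool) :
    (l.map fun x => transfer (foldedRowMatrix x y)).prod s t =
      partitionMatrix (unfoldPairs fun j => (y j, y j)) l (unfoldPairs s) (unfoldPairs t) := by
  induction l generalizing s with
  | nil =>
    have : unfoldPairs s = unfoldPairs t ↔ s = t := (unfoldEquiv Bool N).injective.eq_iff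
    simp [partitionMatrix, Matrix.one_apply, this]
  | cons x l ih =>
    rw [partitionMatrix_cons, ← (unfoldEquiv Bool N).sum_comp, List.map_cons, List.prod_cons,
      Matrix.mul_apply]
    refine Finset.sum_congr rfl fun u _ => ?_
    rw [ih, transfer, Matrix.of_apply, foldedRowMatrix_eq_rowMatrix]
    rfl

theorem forall_unfoldPairs_ne_iff {N : ℕ} (t : Fin N → Bool × Bool) :
    (∀ j, unfoldPairs t j ≠ unfoldPairs t j.rev) ↔ ∀ j, (t j).1 ≠ (t j).2 := by
  constructor
  · intro h j
    have := h (lowerIdx j)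
    rwa [rev_lowerIdx, unfoldPairs_lowerIdx, unfoldPairs_upperIdx] at this
  · intro h i
    rcases exists_lowerIdx_or_upperIdx i with ⟨j, rfl⟩ | ⟨j, rfl⟩
    · rw [rev_lowerIdx, unfoldPairs_lowerIdx, unfoldPairs_upperIdx]
      exact h j
    · rw [rev_upperIdx, unfoldPairs_lowerIdx, unfoldPairs_upperIdx]
      exact (h j).symm

open Classical in
theorem foldedPartition_eq_sum_partitionMatrix {N : ℕ} (y : Fin N → ℝ) (l : List ℝ) :
    foldedPartition y l (fun _ => (false, false)) =
      ∑ t, partitionMatrix (unfoldPairs fun j => (y j, y j)) l (fun _ => false) t *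
        if ∀ j, t j ≠ t j.rev then 1 else 0 := by
  have h0 : unfoldPairs (fun _ : Fin N => (false, false)) = fun _ => false := by
    funext i
    rcases exists_lowerIdx_or_upperIdx i with ⟨j, rfl⟩ | ⟨j, rfl⟩ <;> simp
  rw [foldedPartition, ← (unfoldEquiv Bool N).sum_comp]
  refine Finset.sum_congr rfl fun t _ => ?_
  rw [prod_transfer_foldedRowMatrix, h0]
  congr 1
  exact if_congr (forall_unfoldPairs_ne_iff t).symm rfl rfl

/-- The half-turn symmetric matrix with upper half `A`. -/
def halfTurnMatrix {N : ℕ} (A : Matrix (Fin N) (Fin (2 * N)) SignType) :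
    Matrix (Fin (2 * N)) (Fin (2 * N)) SignType := fun i j =>
  unfoldPairs (fun k => (A k j, A k j.rev)) i

theorem halfTurnMatrix_lowerIdx {N : ℕ} (A : Matrix (Fin N) (Fin (2 * N)) SignType) (i : Fin N)
    (j : Fin (2 * N)) : halfTurnMatrix A (lowerIdx i) j = A i j := by
  simp [halfTurnMatrix]

theorem halfTurnMatrix_upperIdx {N : ℕ} (A : Matrix (Fin N) (Fin (2 * N)) SignType) (i : Fin N)
    (j : Fin (2 * N)) : halfTurnMatrix A (upperIdx i) j = A i j.rev := by
  simp [halfTurnMatrix]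

theorem isHalfTurnSymmetric_halfTurnMatrix {N : ℕ} (A : Matrix (Fin N) (Fin (2 * N)) SignType) :
    IsHalfTurnSymmetric (halfTurnMatrix A) := by
  intro i j
  rcases exists_lowerIdx_or_upperIdx i with ⟨k, rfl⟩ | ⟨k, rfl⟩
  · rw [rev_lowerIdx, halfTurnMatrix_lowerIdx, halfTurnMatrix_upperIdx, Fin.rev_rev]
  · rw [rev_upperIdx, halfTurnMatrix_lowerIdx, halfTurnMatrix_upperIdx]

theorem IsHalfTurnSymmetric.eq_halfTurnMatrix {N : ℕ}
    {M : Matrix (Fin (2 * N)) (Fin (2 * N)) SignType} (hM : IsHalfTurnSymmetric M) :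
    halfTurnMatrix (M.submatrix lowerIdx id) = M := by
  ext i j
  rcases exists_lowerIdx_or_upperIdx i with ⟨k, rfl⟩ | ⟨k, rfl⟩
  · rw [halfTurnMatrix_lowerIdx]; rfl
  · rw [halfTurnMatrix_upperIdx, ← hM (upperIdx k) j, rev_upperIdx]; rfl

theorem numNegOnes_halfTurnMatrix {N : ℕ} (A : Matrix (Fin N) (Fin (2 * N)) SignType) :
    numNegOnes (halfTurnMatrix A) / 2 =
      ∑ i, (Finset.univ.filter fun j => A i j = -1).card := by
  have h : ∀ i, (Finset.univ.filter fun j : Fin (2 * N) => A i j.rev = -1).card =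
      (Finset.univ.filter fun j => A i j = -1).card := by
    intro i
    simp only [Finset.card_filter]
    exact Equiv.sum_comp Fin.revPerm fun j => if A i j = -1 then 1 else 0
  rw [numNegOnes_eq_sum, sum_univ_double]
  simp only [halfTurnMatrix_lowerIdx, halfTurnMatrix_upperIdx, h]
  rw [← Finset.sum_add_distrib.symm, ← two_mul]
  exact Nat.mul_div_cancel_left _ two_pos

theorem boolDiff_not_not (a b : Bool) : boolDiff (!b) (!a) = boolDiff a b := by
  cases a <;> cases b <;> rfl

theorem IsPotential.rev {n : ℕ} {p : Fin (n + 1) → Bool} {v : Fin n → SignType}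
    (hp : IsPotential p v) (hl : p (Fin.last n) = true) :
    IsPotential (fun k => !p k.rev) (fun i => v i.rev) := by
  refine ⟨by simp [hl], fun i => ?_⟩
  change v i.rev = boolDiff (!p i.castSucc.rev) (!p i.succ.rev)
  rw [hp.2, Fin.rev_castSucc, Fin.rev_succ, boolDiff_not_not]

/-- The partial sums of column `j` of the half-turn symmetric matrix whose upper half has the
vertical edges `σ`. -/
def halfTurnPotential {N : ℕ} (σ : Fin (N + 1) → Fin (2 * N) → Bool) (j : Fin (2 * N))
    (k : Fin (2 * N + 1)) : Bool :=
  if h : (k : ℕ) ≤ N then σ ⟨k, by omega⟩ j else !σ ⟨2 * N - k, by omega⟩ j.rev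

theorem halfTurnPotential_of_le {N : ℕ} {σ : Fin (N + 1) → Fin (2 * N) → Bool}
    (hσ : ∀ j, σ (Fin.last N) j ≠ σ (Fin.last N) j.rev) (j : Fin (2 * N)) (k : Fin (2 * N + 1))
    (hk : N ≤ k) : halfTurnPotential σ j k = !σ ⟨2 * N - k, by omega⟩ j.rev := by
  unfold halfTurnPotential
  split_ifs with h
  · have hkN : (k : ℕ) = N := le_antisymm h hk
    have e1 : (⟨k, by omega⟩ : Fin (N + 1)) = Fin.last N := Fin.ext hkN
    have e2 : (⟨2 * N - k, by omega⟩ : Fin (N + 1)) = Fin.last N := by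
      ext; simp only [Fin.val_last]; omega
    rw [e1, e2]
    have := hσ j
    cases h1 : σ (Fin.last N) j <;> cases h2 : σ (Fin.last N) j.rev <;> simp_all
  · rfl

theorem IsIceConfig.isPotential_halfTurn {N : ℕ} {σ : Fin (N + 1) → Fin (2 * N) → Bool}
    {P : Fin N → Fin (2 * N + 1) → Bool} (h : IsIceConfig σ P)
    (hσ : ∀ j, σ (Fin.last N) j ≠ σ (Fin.last N) j.rev) (j : Fin (2 * N)) :
    IsPotential (halfTurnPotential σ j) (fun i => halfTurnMatrix (signMatrix P) i j) := by
  refine ⟨by simpa [halfTurnPotential] using h.top j, fun i => ?_⟩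
  rcases exists_lowerIdx_or_upperIdx i with ⟨k, rfl⟩ | ⟨k, rfl⟩
  · have hk := k.2
    have h1 : ((lowerIdx k).castSucc : ℕ) ≤ N := by simp [lowerIdx, hk.le]
    have h2 : ((lowerIdx k).succ : ℕ) ≤ N := by simp [lowerIdx, hk]
    change halfTurnMatrix (signMatrix P) (lowerIdx k) j = _
    rw [halfTurnMatrix_lowerIdx, halfTurnPotential, halfTurnPotential, dif_pos h1, dif_pos h2]
    exact h.ice k j
  · have hk := k.2
    have h1 : N ≤ ((upperIdx k).castSucc : ℕ) := by simp [upperIdx]; omega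
    have h2 : N ≤ ((upperIdx k).succ : ℕ) := by simp [upperIdx]; omega
    change halfTurnMatrix (signMatrix P) (upperIdx k) j = _
    rw [halfTurnMatrix_upperIdx, halfTurnPotential_of_le hσ _ _ h1,
      halfTurnPotential_of_le hσ _ _ h2, boolDiff_not_not]
    have e1 : (⟨2 * N - (upperIdx k).castSucc, by omega⟩ : Fin (N + 1)) = k.succ := by
      ext; simp [upperIdx]; omega
    have e2 : (⟨2 * N - (upperIdx k).succ, by omega⟩ : Fin (N + 1)) = k.castSucc := by
      ext; simp [upperIdx]; omega
    rw [e1, e2]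
    exact h.ice k j.rev

theorem IsIceConfig.isASM_halfTurnMatrix {N : ℕ} {σ : Fin (N + 1) → Fin (2 * N) → Bool}
    {P : Fin N → Fin (2 * N + 1) → Bool} (h : IsIceConfig σ P)
    (hσ : ∀ j, σ (Fin.last N) j ≠ σ (Fin.last N) j.rev) :
    IsASM (halfTurnMatrix (signMatrix P)) := by
  constructor
  · intro i
    rcases exists_lowerIdx_or_upperIdx i with ⟨k, rfl⟩ | ⟨k, rfl⟩
    · simp only [halfTurnMatrix_lowerIdx]
      exact isAlternatingLine_iff.2 ⟨P k, h.isPotential_row k, h.right k⟩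
    · simp only [halfTurnMatrix_upperIdx]
      exact isAlternatingLine_iff.2 ⟨_, (h.isPotential_row k).rev (h.right k), by simp [h.left]⟩
  · intro j
    refine isAlternatingLine_iff.2 ⟨_, h.isPotential_halfTurn hσ j, ?_⟩
    rw [halfTurnPotential_of_le hσ _ _ (by simp; omega)]
    have : (⟨2 * N - ((Fin.last (2 * N) : Fin (2 * N + 1)) : ℕ), by simp⟩ : Fin (N + 1)) = 0 := by
      ext; simp
    rw [this, h.top]
    rfl

theorem exists_isIceConfig_of_halfTurn {N : ℕ} {M : Matrix (Fin (2 * N)) (Fin (2 * N)) SignType}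
    (hM : IsASM M) (hs : IsHalfTurnSymmetric M) :
    ∃ (σ : Fin (N + 1) → Fin (2 * N) → Bool) (P : Fin N → Fin (2 * N + 1) → Bool),
      IsIceConfig σ P ∧ (∀ j, σ (Fin.last N) j ≠ σ (Fin.last N) j.rev) ∧
        halfTurnMatrix (signMatrix P) = M := by
  choose P hP hPl using fun i => isAlternatingLine_iff.1 (hM.row i)
  choose S hS hSl using fun j => isAlternatingLine_iff.1 (hM.col j)
  have hle : N + 1 ≤ 2 * N + 1 := by omega
  refine ⟨fun k j => S j (Fin.castLE hle k), fun i => P (lowerIdx i),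
    ⟨fun j => (hS j).1, fun i => (hP _).1, fun i => hPl _, fun i j => ?_⟩, fun j => ?_, ?_⟩
  · exact ((hP (lowerIdx i)).2 j).symm.trans ((hS j).2 (lowerIdx i))
  · have hrev := (hS j.rev).rev (hSl j.rev)
    have hs' : ∀ i j, M i.rev j.rev = M i j := hs
    simp only [hs'] at hrev
    change S j (Fin.castLE hle (Fin.last N)) ≠ S j.rev (Fin.castLE hle (Fin.last N))
    rw [(hS j).unique hrev]
    have : (Fin.castLE hle (Fin.last N)).rev = Fin.castLE hle (Fin.last N) := by
      ext; simp [Fin.val_rev]; omega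
    simp [this]
  · conv_rhs => rw [← hs.eq_halfTurnMatrix]
    congr 1
    ext i j
    exact ((hP (lowerIdx i)).2 j).symm

theorem IsAlternatingLine.zero_ne_neg_one {n : ℕ} {v : Fin (n + 1) → SignType}
    (hv : IsAlternatingLine v) : v 0 ≠ -1 := by
  obtain ⟨p, hp, -⟩ := isAlternatingLine_iff.1 hv
  rw [hp.2 0, Fin.castSucc_zero, hp.1]
  cases p (Fin.succ 0) <;> decide

/-! ### The refined half-turn enumeration -/

/-- The two outer vertices in row `i` of the upper half are, up to a half-turn, the vertices of the
first column in row `i` and in its mirror image. -/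
theorem prod_tilt_halfTurn {m : ℕ} (w : ℝ)
    {σ : Fin (m + 1 + 1) → Fin (2 * (m + 1)) → Bool}
    {P : Fin (m + 1) → Fin (2 * (m + 1) + 1) → Bool} (h : IsIceConfig σ P)
    (hσ : ∀ j, σ (Fin.last _) j ≠ σ (Fin.last _) j.rev) (r : Fin (2 * (m + 1)))
    (hr : halfTurnMatrix (signMatrix P) r (lowerIdx 0) = 1)
    (hv : ∀ i, halfTurnMatrix (signMatrix P) i (lowerIdx 0) ≠ -1) (i : Fin (m + 1)) :
    tilt w (P i (lowerIdx (0 : Fin (m + 1))).castSucc) (σ i.castSucc (lowerIdx 0))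
        (P i (lowerIdx (0 : Fin (m + 1))).succ) *
      tilt w (P i (upperIdx (0 : Fin (m + 1))).castSucc) (σ i.castSucc (upperIdx 0))
        (P i (upperIdx (0 : Fin (m + 1))).succ) =
      (if lowerIdx i < r then 2 * w else if lowerIdx i = r then 1 else 2 * (1 - w)) *
        (if upperIdx i < r then 2 * w else if upperIdx i = r then 1 else 2 * (1 - w)) := by
  have hcol := h.isPotential_halfTurn hσ (lowerIdx 0)
  have hq : ∀ k, halfTurnPotential σ (lowerIdx 0) k = true ↔ r.castSucc < k := by
    intro k
    rw [hcol.eq_true_iff hv]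
    constructor
    · rintro ⟨i, hi, hi1⟩
      rwa [hcol.eq_of_eq_one hv hr hi1]
    · exact fun h => ⟨r, h, hr⟩
  have hone : ∀ i, halfTurnMatrix (signMatrix P) i (lowerIdx 0) = 1 ↔ i = r := fun i =>
    ⟨fun h => hcol.eq_of_eq_one hv h hr, fun h => h ▸ hr⟩
  have hi := i.2
  congr 1
  · have hl : P i (lowerIdx (0 : Fin (m + 1))).castSucc = false := h.left i
    have h1 := hone (lowerIdx i)
    rw [halfTurnMatrix_lowerIdx, signMatrix, hl] at h1
    have h2 := hq (lowerIdx i).castSucc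
    rw [halfTurnPotential, dif_pos (by simp [lowerIdx]), Fin.castSucc_lt_castSucc_iff] at h2
    change σ i.castSucc (lowerIdx 0) = true ↔ _ at h2
    rw [hl]
    rcases lt_trichotomy (lowerIdx i) r with hlt | heq | hgt
    · rw [if_pos hlt]
      have e1 := (not_congr h2).2 hlt.not_gt
      have e2 := (not_congr h1).2 hlt.ne
      cases e3 : P i (lowerIdx (0 : Fin (m + 1))).succ <;> simp_all [boolDiff, tilt]
    · rw [if_neg heq.not_lt, if_pos heq]
      have e2 := h1.2 heq
      cases e3 : P i (lowerIdx (0 : Fin (m + 1))).succ <;> simp_all [boolDiff, tilt]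
    · rw [if_neg hgt.not_gt, if_neg hgt.ne']
      have e1 := h2.2 hgt
      have e2 := (not_congr h1).2 hgt.ne'
      cases e3 : P i (lowerIdx (0 : Fin (m + 1))).succ <;> simp_all [boolDiff, tilt]
  · have hl : P i (upperIdx (0 : Fin (m + 1))).succ = true := by
      rw [← h.right i]
      congr 1
    have h1 := hone (upperIdx i)
    rw [halfTurnMatrix_upperIdx, rev_lowerIdx, signMatrix, hl] at h1
    have h2 := hq (upperIdx i).succ
    rw [halfTurnPotential_of_le hσ _ _ (by simp [upperIdx]; omega), rev_lowerIdx] at h2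
    have e : (⟨2 * (m + 1) - (upperIdx i).succ, by simp [upperIdx]; omega⟩ : Fin (m + 1 + 1)) =
        i.castSucc := by
      ext; simp [upperIdx]; omega
    rw [e, Fin.castSucc_lt_succ_iff] at h2
    rw [hl]
    rcases lt_trichotomy (upperIdx i) r with hlt | heq | hgt
    · rw [if_pos hlt]
      have e1 := (not_congr h2).2 hlt.not_ge
      have e2 := (not_congr h1).2 hlt.ne
      cases e3 : P i (upperIdx (0 : Fin (m + 1))).castSucc <;> simp_all [boolDiff, tilt]
    · rw [if_neg heq.not_lt, if_pos heq]
      have e2 := h1.2 heq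
      cases e3 : P i (upperIdx (0 : Fin (m + 1))).castSucc <;> simp_all [boolDiff, tilt]
    · rw [if_neg hgt.not_gt, if_neg hgt.ne']
      have e1 := h2.2 hgt.le
      have e2 := (not_congr h1).2 hgt.ne'
      cases e3 : P i (upperIdx (0 : Fin (m + 1))).castSucc <;> simp_all [boolDiff, tilt]

open Classical in
theorem refinedCountHT_sum_eq {m : ℕ} (f : Fin (2 * (m + 1)) → ℝ) (x : ℝ) :
    ∑ r, refinedCountHT (m + 1) r x * f r =
      ∑ M : Matrix (Fin (2 * (m + 1))) (Fin (2 * (m + 1))) SignType with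
        IsASM M ∧ IsHalfTurnSymmetric M,
        ∑ r, if M r (lowerIdx 0) = 1 then x ^ (numNegOnes M / 2) * f r else 0 := by
  rw [Finset.sum_comm]
  refine Finset.sum_congr rfl fun r _ => ?_
  rw [refinedCountHT, Finset.sum_mul, Finset.sum_filter, Finset.sum_filter]
  refine Finset.sum_congr rfl fun M _ => ?_
  simp only [ite_and]
  rfl

/-- With a special first column and weight `1 / 2` elsewhere, the half-turn symmetric partition
function is the refined enumeration, homogenized in `2 * w` and `2 * (1 - w)`. -/
theorem foldedPartition_eq_refinedCountHT (m : ℕ) (w : ℝ) :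
    foldedPartition (Fin.cons (1 / 2 - w) fun _ => 0 : Fin (m + 1) → ℝ)
        ((List.finRange (m + 1)).map fun _ => 1 / 2) (fun _ => (false, false)) =
      ((1 / 2) ^ (2 * (m + 1)) * 2) ^ (m + 1) *
        ∑ r : Fin (2 * (m + 1)), refinedCountHT (m + 1) r (4 : ℝ) *
          ((2 * w) ^ (r : ℕ) * (2 * (1 - w)) ^ (2 * (m + 1) - 1 - r : ℕ)) := by
  classical
  rw [foldedPartition_eq_sum_partitionMatrix]
  refine Eq.trans (Finset.sum_congr rfl fun t _ => ?_) <|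
    (sum_partitionMatrix_eq (n := m + 1) (unfoldPairs fun j =>
    ((Fin.cons (1 / 2 - w) fun _ => 0 : Fin (m + 1) → ℝ) j,
      (Fin.cons (1 / 2 - w) fun _ => 0 : Fin (m + 1) → ℝ) j)) (1 / 2)
    (fun t => ∀ j, t j ≠ t j.rev)).trans ?_
  · congr
  rw [refinedCountHT_sum_eq, Finset.mul_sum]
  refine Finset.sum_bij (fun q _ => halfTurnMatrix (signMatrix q.2)) ?_ ?_ ?_ ?_
  · rintro ⟨σ, P⟩ hq
    simp only [Finset.mem_filter, Finset.mem_univ, true_and] at hq ⊢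
    exact ⟨hq.1.isASM_halfTurnMatrix hq.2, isHalfTurnSymmetric_halfTurnMatrix _⟩
  · rintro ⟨σ, P⟩ hq ⟨σ', P'⟩ hq' he
    simp only [Finset.mem_filter, Finset.mem_univ, true_and] at hq hq' he
    have he' : signMatrix P = signMatrix P' := by
      ext i j
      rw [← halfTurnMatrix_lowerIdx (signMatrix P), he, halfTurnMatrix_lowerIdx]
    have hP : P = P' := funext fun i =>
      (hq.1.isPotential_row i).unique (he' ▸ hq'.1.isPotential_row i)
    have hσ : ∀ j, (fun k => σ k j) = fun k => σ' k j := fun j =>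
      (hq.1.isPotential_col j).unique (he' ▸ hq'.1.isPotential_col j)
    rw [hP, show σ = σ' from funext fun k => funext fun j => congrFun (hσ j) k]
  · intro M hM
    simp only [Finset.mem_filter, Finset.mem_univ, true_and] at hM
    obtain ⟨σ, P, hc, hσ, he⟩ := exists_isIceConfig_of_halfTurn hM.1 hM.2
    exact ⟨(σ, P), by simp only [Finset.mem_filter, Finset.mem_univ, true_and]; exact ⟨hc, hσ⟩, he⟩
  · rintro ⟨σ, P⟩ hq
    simp only [Finset.mem_filter, Finset.mem_univ, true_and] at hq
    obtain ⟨hc, hσ⟩ := hq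
    have hasm := hc.isASM_halfTurnMatrix hσ
    have hcol := hc.isPotential_halfTurn hσ (lowerIdx 0)
    have hv : ∀ i, halfTurnMatrix (signMatrix P) i (lowerIdx 0) ≠ -1 :=
      fun i => (hasm.row i).zero_ne_neg_one (n := 2 * m + 1)
    obtain ⟨p, hp, hpl⟩ := isAlternatingLine_iff.1 (hasm.col (lowerIdx 0))
    obtain ⟨r, -, hr⟩ := (hp.eq_true_iff hv (Fin.last _)).1 hpl
    rw [hc.prod_vertexWeight fun j => 1 / 2 - unfoldPairs (fun j =>
      ((Fin.cons (1 / 2 - w) fun _ => 0 : Fin (m + 1) → ℝ) j,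
        (Fin.cons (1 / 2 - w) fun _ => 0 : Fin (m + 1) → ℝ) j)) j, Finset.sum_eq_single r
      (fun s _ hs => if_neg fun h => hs (hcol.eq_of_eq_one hv h hr)) (by simp), if_pos hr,
      prod_univ_double, numNegOnes_halfTurnMatrix, ← prod_ite_lt_eq, prod_univ_double,
      Fin.prod_univ_succ]
    simp only [unfoldPairs_lowerIdx, unfoldPairs_upperIdx, Fin.cons_succ, sub_zero, tilt_half,
      Finset.prod_const_one, mul_one, Fin.cons_zero, sub_sub_cancel]
    rw [mul_assoc, ← Finset.prod_mul_distrib]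
    congr 2
    exact Finset.prod_congr rfl fun i _ => prod_tilt_halfTurn w hc hσ r hr hv i

/-! ### The identity over the reals and over commutative rings -/

theorem map_refinedEnum {R S : Type*} [CommRing R] [CommRing S] (f : R →+* S) (n : ℕ) (t x : R) :
    f (refinedEnum n t x) = refinedEnum n (f t) (f x) := by
  simp [refinedEnum, refinedCount]

theorem map_refinedEnumHT {R S : Type*} [CommRing R] [CommRing S] (f : R →+* S) (m : ℕ)
    (t x : R) : f (refinedEnumHT m t x) = refinedEnumHT m (f t) (f x) := by
  simp [refinedEnumHT, refinedCountHT]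

theorem sum_mul_pow_mul_pow (n : ℕ) (c : Fin n → ℝ) (a b : ℝ) (hb : b ≠ 0) :
    ∑ r, c r * (a ^ (r : ℕ) * b ^ (n - 1 - r : ℕ)) =
      b ^ (n - 1) * ∑ r, c r * (a / b) ^ (r : ℕ) := by
  rw [Finset.mul_sum]
  refine Finset.sum_congr rfl fun r _ => ?_
  have h : b ^ (n - 1) = b ^ (n - 1 - r : ℕ) * b ^ (r : ℕ) := by
    rw [← pow_add]; congr 1; omega
  rw [h, div_pow]
  field_simp

/-- The case of a positive real `t`, obtained at `w = t / (1 + t)`. -/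
theorem refinedEnumHT_four_of_pos (m : ℕ) (t : ℝ) (ht : 0 < t) :
    refinedEnumHT (m + 1) t (4 : ℝ) = 2 ^ m * (1 + t) * refinedEnum (m + 1) t 4 ^ 2 := by
  have ht1 : (1 + t) ≠ 0 := by positivity
  have hb : 2 * (1 - t / (1 + t)) = 2 / (1 + t) := by field_simp; ring
  have hb0 : 2 / (1 + t) ≠ 0 := by positivity
  have hab : 2 * (t / (1 + t)) / (2 / (1 + t)) = t := by field_simp
  have h := foldedPartition_eq_sq (Fin.cons (1 / 2 - t / (1 + t)) fun _ => 0 : Fin (m + 1) → ℝ)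
    (1 / 2)
  rw [foldedPartition_eq_refinedCountHT, partitionMatrix_eq_refinedCount, hb,
    sum_mul_pow_mul_pow _ _ _ _ hb0, sum_mul_pow_mul_pow _ _ _ _ hb0, hab] at h
  change _ * (_ * refinedEnumHT (m + 1) t 4) = (_ * (_ * refinedEnum (m + 1) t 4)) ^ 2 at h
  generalize refinedEnumHT (m + 1) t 4 = X at h ⊢
  generalize refinedEnum (m + 1) t 4 = Y at h ⊢
  have e1 : 2 * (m + 1) - 1 = 2 * m + 1 := by omega
  have e2 : m + 1 - 1 = m := by omega
  rw [e1, e2] at h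
  have e3 : (((1 / 2 : ℝ) ^ (m + 1) * 2) ^ (m + 1)) ^ 2 =
      ((1 / 2 : ℝ) ^ (2 * (m + 1)) * 2) ^ (m + 1) * 2 ^ (m + 1) := by
    rw [mul_comm 2 (m + 1), pow_mul (1 / 2 : ℝ), ← mul_pow, pow_right_comm]
    congr 1
    ring
  have hA : ((1 / 2 : ℝ) ^ (2 * (m + 1)) * 2) ^ (m + 1) ≠ 0 := by positivity
  generalize ((1 / 2 : ℝ) ^ (2 * (m + 1)) * 2) ^ (m + 1) = A at h e3 hA
  generalize ((1 / 2 : ℝ) ^ (m + 1) * 2) ^ (m + 1) = D at h e3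
  have h3 : X * (2 / (1 + t)) = 2 ^ (m + 1) * Y ^ 2 := by
    generalize 2 / (1 + t) = B at h hb0 ⊢
    refine mul_left_cancel₀ (mul_ne_zero hA (pow_ne_zero (2 * m) hb0)) ?_
    linear_combination h + B ^ (2 * m) * Y ^ 2 * e3
  field_simp at h3
  linear_combination h3 / 2

theorem mainTheorem7 {R : Type*} [CommRing R] (m : ℕ) (hm : 1 ≤ m) (t : R) :
    refinedEnumHT m t 4 = 2 ^ (m - 1) * (1 + t) * refinedEnum m t 4 ^ 2 := by
  obtain ⟨m, rfl⟩ := Nat.exists_eq_add_of_le' hm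
  rw [Nat.add_sub_cancel]
  open Polynomial in
  have key : refinedEnumHT (m + 1) (X : ℤ[X]) 4 =
      2 ^ m * (1 + X) * refinedEnum (m + 1) (X : ℤ[X]) 4 ^ 2 := by
    refine Polynomial.map_injective (Int.castRingHom ℝ) Int.cast_injective ?_
    refine Polynomial.eq_of_infinite_eval_eq _ _
      ((Set.Ioi_infinite (0 : ℝ)).mono fun t ht => ?_)
    change (Polynomial.map _ _).eval t = (Polynomial.map _ _).eval t
    rw [Polynomial.eval_map, Polynomial.eval_map, ← Polynomial.coe_eval₂RingHom]
    simp only [map_mul, map_pow, map_add, map_one, map_ofNat, map_refinedEnum, map_refinedEnumHT]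
    rw [Polynomial.coe_eval₂RingHom, Polynomial.eval₂_X]
    exact refinedEnumHT_four_of_pos m t ht
  have h := congrArg (Polynomial.eval₂RingHom (Int.castRingHom R) t) key
  simp only [map_mul, map_pow, map_add, map_one, map_ofNat, map_refinedEnum,
    map_refinedEnumHT] at h
  rwa [Polynomial.coe_eval₂RingHom, Polynomial.eval₂_X] at h
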